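/- Let $r \ge 3$ be a fixed integer. An instance of \textsc{$r$-Dense Feedback Arc Set} ($r$-FAST) consists of a finite vertex set $V$, a selected vertex $\mathrm{sel}(S) \in S$ for every set $S \subseteq V$ with $|S| = r$ (such sets $S$ are the constraints), and a parameter $k \in \mathbb{N} = \{0, 1, 2, \dots\}$. A ranking (linear order) $\sigma$ of $V$ satisfies the constraint $S$ if $u <_\sigma \mathrm{sel}(S)$ for every $u \in S \setminus \{\mathrm{sel}(S)\}$. The instance is a \textsc{Yes}-instance if some ranking of $V$ satisfies all but at most $k$ of the constraints. Theorem. For every fixed $r \ge 3$, $r$-FAST admits a kernel with at most $6k + r$ vertices. That is, there is an algorithm, running in time polynomial in the size of its input, that transforms every instance $(V, \mathrm{sel}, k)$ of $r$-FAST into an instance $(V', \mathrm{sel}', k')$ of $r$-FAST such that (i) $(V', \mathrm{sel}', k')$ is a \textsc{Yes}-instance if and only if $(V, \mathrm{sel}, k)$ is a \textsc{Yes}-instance; (ii) $k' \le k$; (iii) $|V'| \le 6k + r$ if $k \ge 1$, and $|V'| \le r + 1$ if $k = 0$. -/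

import Mathlib

/-! ## The problem: dense feedback arc set with constraints of arity `r` -/

namespace DenseFAS

/-- The constraints of a dense instance on the vertex set `Fin n`: all `r`-element subsets. -/
abbrev Constraint (r n : ℕ) : Type := {S : Finset (Fin n) // S.card = r}

/-- A ranking of the vertices; `σ v` is the position of `v`, and `u <_σ v` is `σ u < σ v`. -/
abbrev Ranking (n : ℕ) : Type := Equiv.Perm (Fin n)

/-- An instance: `n` vertices (named `0, …, n - 1`), one selected vertex in every `r`-element set
of vertices, and the parameter `k`. -/
structure Instance (r : ℕ) where
  n : ℕ
  sel : Constraint r n → Fin n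
  sel_mem : ∀ S, sel S ∈ S.1
  k : ℕ

variable {r : ℕ}

/-- The constraint system: `0` if the constraint `S` is satisfied by the ranking, that is, if every
other vertex of `S` is ranked before the selected one, and `1` if it is not. -/
def Instance.c (R : Instance r) (σ : Ranking R.n) (S : Constraint r R.n) : ℕ :=
  if ∀ u ∈ S.1, u ≠ R.sel S → σ u < σ (R.sel S) then 0 else 1

/-- The number of constraints that are not satisfied by a ranking. -/
def Instance.cost (R : Instance r) (σ : Ranking R.n) : ℕ :=
  ∑ S : Constraint r R.n, R.c σ S

/-- Some ranking satisfies all but at most `k` constraints. -/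
def Instance.IsYes (R : Instance r) : Prop :=
  ∃ σ : Ranking R.n, R.cost σ ≤ R.k

/-- The selected vertex of a set of `r` vertices, as a number. (The value `0` on sets of another
size is never used.) -/
def Instance.selVal (R : Instance r) (S : Finset (Fin R.n)) : ℕ :=
  if h : S.card = r then (R.sel ⟨S, h⟩ : ℕ) else 0

/-- An instance written as a list of numbers: the number of vertices, the parameter, and then, for
every set of `r` vertices, its elements in increasing order followed by its selected vertex. -/
def Instance.encode (R : Instance r) : List ℕ :=
  R.n :: R.k :: ((List.finRange R.n).sublistsLen r).flatMap
    fun l => l.map Fin.val ++ [R.selVal l.toFinset]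

end DenseFAS

/-! ## Polynomial time: structured programs on a random access machine

A machine has natural-number registers `x₀, x₁, …` and arrays `A₀, A₁, …` of natural numbers, of
which a program mentions finitely many. The arithmetic operations are addition and truncated
subtraction only (no multiplication), so that the unit-cost measure is polynomially related to
Turing machine time. -/

namespace RAM

/-- The contents of the registers and of the arrays. -/
structure Store where
  var : ℕ → ℕ
  arr : ℕ → ℕ → ℕ

/-- Expressions: constants, registers, array entries `A_a[i]`, sums and truncated differences. -/
inductive Expr : Type
  | lit (m : ℕ)
  | var (x : ℕ)
  | get (a : ℕ) (i : Expr)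
  | add (e₁ e₂ : Expr)
  | sub (e₁ e₂ : Expr)

/-- The value of an expression. -/
def Expr.eval (s : Store) : Expr → ℕ
  | .lit m => m
  | .var x => s.var x
  | .get a i => s.arr a (i.eval s)
  | .add e₁ e₂ => e₁.eval s + e₂.eval s
  | .sub e₁ e₂ => e₁.eval s - e₂.eval s

/-- Programs. A test `e` succeeds if the value of `e` is not `0`. -/
inductive Prog : Type
  | skip
  | assign (x : ℕ) (e : Expr)
  | write (a : ℕ) (i e : Expr)
  | seq (p q : Prog)
  | cond (e : Expr) (p q : Prog)
  | loop (e : Expr) (p : Prog)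

/-- `Runs p s s' t`: started in the store `s`, the program `p` halts in the store `s'` after `t`
steps, where each assignment, array write and test counts as one step. -/
inductive Runs : Prog → Store → Store → ℕ → Prop
  | skip (s : Store) : Runs .skip s s 1
  | assign (s : Store) (x : ℕ) (e : Expr) :
      Runs (.assign x e) s { s with var := Function.update s.var x (e.eval s) } 1
  | write (s : Store) (a : ℕ) (i e : Expr) :
      Runs (.write a i e) s
        { s with arr := Function.update s.arr a
                  (Function.update (s.arr a) (i.eval s) (e.eval s)) } 1
  | seq {p q : Prog} {s s' s'' : Store} {t t' : ℕ} :
      Runs p s s' t → Runs q s' s'' t' → Runs (.seq p q) s s'' (t + t')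
  | cond_true {e : Expr} {p q : Prog} {s s' : Store} {t : ℕ} :
      e.eval s ≠ 0 → Runs p s s' t → Runs (.cond e p q) s s' (t + 1)
  | cond_false {e : Expr} {p q : Prog} {s s' : Store} {t : ℕ} :
      e.eval s = 0 → Runs q s s' t → Runs (.cond e p q) s s' (t + 1)
  | loop_done {e : Expr} {p : Prog} {s : Store} :
      e.eval s = 0 → Runs (.loop e p) s s 1
  | loop_step {e : Expr} {p : Prog} {s s' s'' : Store} {t t' : ℕ} :
      e.eval s ≠ 0 → Runs p s s' t → Runs (.loop e p) s' s'' t' →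
        Runs (.loop e p) s s'' (t + t' + 1)

/-- The initial store: the input is in the array `A₀`, its number of entries is in the register
`x₀`, and everything else is `0`. -/
def Store.input (l : List ℕ) : Store where
  var x := if x = 0 then l.length else 0
  arr a i := if a = 0 then l.getD i 0 else 0

/-- The output of a store: the first `x₀` entries of the array `A₀`. -/
def Store.output (s : Store) : List ℕ :=
  (List.range (s.var 0)).map (s.arr 0)

/-- The length of an input: its numbers are counted in binary, with one separator each. -/
def bitLength (l : List ℕ) : ℕ :=
  (l.map fun m => Nat.size m + 1).sum

/-- A function is computable in polynomial time with respect to encodings of its arguments and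
its values: one program computes it on all inputs, in a number of steps that is polynomial in the
length of the input. -/
def PolyTimeComputable {α β : Type} (encα : α → List ℕ) (encβ : β → List ℕ) (f : α → β) : Prop :=
  ∃ (p : Prog) (P : Polynomial ℕ), ∀ x : α, ∃ (s : Store) (t : ℕ),
    Runs p (Store.input (encα x)) s t ∧ t ≤ P.eval (bitLength (encα x)) ∧ s.output = encβ (f x)

end RAM

namespace DenseFAS

/-- The problem with constraints of arity `r` admits a kernel with at most `g k` vertices: some
polynomial-time algorithm turns every instance with parameter `k` into an equivalent instance with
at most `g k` vertices and a parameter that is at most `k`. -/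
def AdmitsVertexKernel (r : ℕ) (g : ℕ → ℕ) : Prop :=
  ∃ f : Instance r → Instance r,
    RAM.PolyTimeComputable Instance.encode Instance.encode f ∧
      ∀ R : Instance r,
        ((f R).IsYes ↔ R.IsYes) ∧ (f R).n ≤ g R.k ∧ (f R).k ≤ R.k

end DenseFAS

/-!
Let `W` be a set of at least `2 * m + r` vertices. Two distinct vertices of `W` occur together in
`(|W| - 2).choose (r - 2) ≥ |W| - r + 1 > 2 * m` constraints on `W`, and each of these is lost by
one of the two, in the sense that it contains this vertex without selecting it. Hence at most one
vertex loses at most `m` constraints. A ranking violates all the constraints that its last vertex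
loses, so in a ranking of cost at most `m` the last vertex has to be that one. Since all vertices
occur in equally many constraints, it is also the one that wins (is selected in) the most.

So we repeatedly remove a vertex with the most wins and charge its losses to the budget, until at
most `2 * k + (r - 1)` vertices remain. As each removed vertex wins or loses every constraint that
disappears with it, the budget is then `k` plus the wins of the removed vertices minus the number of
constraints that are not contained in the set of remaining vertices. If it is negative, the answer
is a fixed `No`-instance on `r + 1` vertices.
-/

namespace DenseFAS

/-! ## The last vertex of a ranking -/

section Peeling

open Finset

variable {α β : Type*} {r k m w : ℕ} {u v : α}

/-- Among the vertices in `S`, the ranking `g` puts `v` last. -/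
abbrev IsLast [LT β] (g : α → β) (v : α) (S : Finset α) : Prop :=
  ∀ u ∈ S, u ≠ v → g u < g v

/-- The function `s` selects a vertex in each constraint on the vertex set `W`; its values on other
sets are irrelevant. -/
def IsSelection (r : ℕ) (s : Finset α → α) (W : Finset α) : Prop :=
  ∀ S ∈ W.powersetCard r, s S ∈ S

theorem IsSelection.mono {s : Finset α → α} {V W : Finset α} (hs : IsSelection r s V)
    (h : W ⊆ V) : IsSelection r s W :=
  fun S hS => hs S (powersetCard_mono h hS)

theorem add_one_sub_le_choose {n t : ℕ} (ht : t ≠ 0) : n + 1 - t ≤ n.choose t := by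
  induction n generalizing t with
  | zero => omega
  | succ n ih =>
    obtain ⟨t, rfl⟩ := Nat.exists_eq_succ_of_ne_zero ht
    rw [Nat.choose_succ_succ']
    rcases lt_or_ge n t with h | h
    · omega
    · have := Nat.choose_pos h
      have := ih (t := t + 1) (by omega)
      omega

variable [DecidableEq α] {s : Finset α → α} {g g' : α → ℕ} {V W : Finset α}

/-- The constraints on `W` that the ranking `g` violates. -/
def violated (r : ℕ) (s : Finset α → α) (g : α → ℕ) (W : Finset α) : Finset (Finset α) :=
  {S ∈ W.powersetCard r | ¬ IsLast g (s S) S}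

/-- The constraints on `W` in which `v` is selected. -/
def won (r : ℕ) (s : Finset α → α) (W : Finset α) (v : α) : Finset (Finset α) :=
  {S ∈ W.powersetCard r | s S = v}

/-- The constraints on `W` in which `v` occurs without being selected. -/
def lost (r : ℕ) (s : Finset α → α) (W : Finset α) (v : α) : Finset (Finset α) :=
  {S ∈ W.powersetCard r | v ∈ S ∧ s S ≠ v}

/-- The constraints on `V` that contain a vertex outside `W`. Their fate is settled as soon as the
vertices in `V \ W` are known to be the last ones, in a known order. -/
def settled (r : ℕ) (V W : Finset α) : Finset (Finset α) :=
  {S ∈ V.powersetCard r | ¬ S ⊆ W}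

/-- Some ranking of `W` violates at most `m` constraints. Rankings are encoded as functions to `ℕ`
that are injective on `W`, so that they can be restricted to subsets of `W`. -/
def IsYesOn (r : ℕ) (s : Finset α → α) (W : Finset α) (m : ℕ) : Prop :=
  ∃ g : α → ℕ, Set.InjOn g W ∧ #(violated r s g W) ≤ m

theorem card_powersetCard_filter_mem (hr : r ≠ 0) (hv : v ∈ W) :
    #{S ∈ W.powersetCard r | v ∈ S} = (#W - 1).choose (r - 1) := by
  simpa using card_filter_powersetCard_subset {v} W r (by simpa using hv)
    (by simpa using Nat.one_le_iff_ne_zero.2 hr)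

theorem card_won_add_card_lost (hr : r ≠ 0) (hs : IsSelection r s W) (hv : v ∈ W) :
    #(won r s W v) + #(lost r s W v) = (#W - 1).choose (r - 1) := by
  have hwon : won r s W v = {S ∈ W.powersetCard r | v ∈ S ∧ s S = v} :=
    filter_congr fun S hS => (and_iff_right_of_imp fun h => h ▸ hs S hS).symm
  rw [hwon, lost, ← filter_filter, ← filter_filter, card_filter_add_card_filter_not,
    card_powersetCard_filter_mem hr hv]

theorem choose_le_card_lost_add_card_lost (hr : 2 ≤ r) (hu : u ∈ W) (hv : v ∈ W) (huv : u ≠ v) :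
    (#W - 2).choose (r - 2) ≤ #(lost r s W u) + #(lost r s W v) := by
  have hpair : #{S ∈ W.powersetCard r | {u, v} ⊆ S} = (#W - 2).choose (r - 2) := by
    rw [card_filter_powersetCard_subset _ _ _ (by simp [insert_subset_iff, hu, hv])
      (by rwa [card_pair huv]), card_pair huv]
  rw [← hpair]
  refine (card_le_card fun S hS => ?_).trans (card_union_le _ _)
  simp only [lost, mem_union, mem_filter, insert_subset_iff, singleton_subset_iff] at hS ⊢
  grind

theorem eq_of_card_lost_le (hr : 3 ≤ r) (hW : 2 * m + r ≤ #W) (hu : u ∈ W) (hv : v ∈ W)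
    (hlu : #(lost r s W u) ≤ m) (hlv : #(lost r s W v) ≤ m) : u = v := by
  by_contra huv
  have := choose_le_card_lost_add_card_lost (r := r) (s := s) (by omega) hu hv huv
  have := add_one_sub_le_choose (n := #W - 2) (t := r - 2) (by omega)
  omega

theorem card_violated_of_isLast (hs : IsSelection r s W) (hg : IsLast g v W) :
    #(violated r s g W) = #(violated r s g (W.erase v)) + #(lost r s W v) := by
  rw [← card_filter_add_card_filter_not (s := violated r s g W) (fun S => v ∉ S)]
  congr 2
  · ext S
    simp only [violated, mem_filter, mem_powersetCard, subset_erase]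
    tauto
  · ext S
    simp only [violated, lost, mem_filter, not_not]
    refine ⟨fun ⟨⟨hS, hviol⟩, hvS⟩ => ⟨hS, hvS, fun hsel => hviol fun u hu hne => ?_⟩,
      fun ⟨hS, hvS, hsel⟩ => ⟨⟨hS, fun hsat => ?_⟩, hvS⟩⟩
    · rw [hsel] at hne ⊢
      exact hg u ((mem_powersetCard.1 hS).1 hu) hne
    · exact (hsat v hvS hsel.symm).not_gt
        (hg (s S) ((mem_powersetCard.1 hS).1 (hs S hS)) hsel)

theorem violated_congr (hs : IsSelection r s W) (h : ∀ u ∈ W, g u = g' u) :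
    violated r s g W = violated r s g' W := by
  refine filter_congr fun S hS => not_congr <| forall₂_congr fun u hu => ?_
  have hSW := (mem_powersetCard.1 hS).1
  rw [h u (hSW hu), h _ (hSW (hs S hS))]

theorem IsYesOn.congr {s' : Finset α → α} (hs : ∀ S ∈ W.powersetCard r, s S = s' S)
    (h : IsYesOn r s W m) : IsYesOn r s' W m := by
  obtain ⟨g, hg, hm⟩ := h
  have hviol : violated r s' g W = violated r s g W := filter_congr fun S hS => by rw [hs S hS]
  exact ⟨g, hg, hviol ▸ hm⟩

theorem IsYesOn.exists_isLast (h : IsYesOn r s W m) (hs : IsSelection r s W) (hW : W.Nonempty) :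
    ∃ v ∈ W, #(lost r s W v) ≤ m ∧ IsYesOn r s (W.erase v) (m - #(lost r s W v)) := by
  obtain ⟨g, hg, hm⟩ := h
  obtain ⟨v, hv, hmax⟩ := exists_max_image W g hW
  have hlast : IsLast g v W := fun u hu hne =>
    lt_of_le_of_ne (hmax u hu) fun heq => hne (hg hu hv heq)
  have hcost := card_violated_of_isLast hs hlast
  exact ⟨v, hv, by omega, g, hg.mono (by simp), by omega⟩

theorem IsYesOn.of_erase (hs : IsSelection r s W) (h : IsYesOn r s (W.erase v) m) :
    IsYesOn r s W (m + #(lost r s W v)) := by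
  obtain ⟨g, hg, hm⟩ := h
  set g' := Function.update g v (W.sup g + 1)
  have hagree : ∀ u, u ≠ v → g' u = g u := fun u hu => Function.update_of_ne hu _ _
  have hlast : IsLast g' v W := fun u hu hne => by
    simpa [g', hne] using Nat.lt_succ_of_le (le_sup (f := g) hu)
  refine ⟨g', fun x hx y hy hxy => ?_, ?_⟩
  · have := hlast x hx
    have := hlast y hy
    by_cases hxv : x = v <;> by_cases hyv : y = v
    all_goals try grind
    rw [hagree x hxv, hagree y hyv] at hxy
    exact hg (by simp_all) (by simp_all) hxy
  · rw [card_violated_of_isLast hs hlast, violated_congr (g' := g) (hs.mono (erase_subset v W))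
      fun u hu => hagree u (ne_of_mem_erase hu)]
    omega

theorem isYesOn_iff_erase (hr : 3 ≤ r) (hs : IsSelection r s W) (hW : 2 * m + r ≤ #W)
    (hv : v ∈ W) (hmax : ∀ u ∈ W, #(won r s W u) ≤ #(won r s W v)) :
    IsYesOn r s W m ↔
      #(lost r s W v) ≤ m ∧ IsYesOn r s (W.erase v) (m - #(lost r s W v)) := by
  refine ⟨fun h => ?_, fun ⟨hle, h⟩ => by simpa [hle] using h.of_erase hs⟩
  obtain ⟨u, hu, hle, h⟩ := h.exists_isLast hs ⟨v, hv⟩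
  have hlost : #(lost r s W v) ≤ #(lost r s W u) := by
    have := card_won_add_card_lost (by omega) hs hu
    have := card_won_add_card_lost (by omega) hs hv
    have := hmax u hu
    omega
  obtain rfl := eq_of_card_lost_le hr hW hu hv hle (hlost.trans hle)
  exact ⟨hle, h⟩

theorem settled_self : settled r W W = ∅ := by
  simp +contextual [settled, filter_eq_empty_iff, mem_powersetCard]

theorem card_settled_erase (hr : r ≠ 0) (hWV : W ⊆ V) (hv : v ∈ W) :
    #(settled r V (W.erase v)) = #(settled r V W) + (#W - 1).choose (r - 1) := by
  rw [← card_powersetCard_filter_mem hr hv,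
    ← card_filter_add_card_filter_not (s := settled r V (W.erase v)) (fun S => ¬ S ⊆ W)]
  congr 2 <;> ext S <;> simp only [settled, mem_filter, mem_powersetCard, subset_erase]
  · tauto
  · have : S ⊆ W → S ⊆ V := (·.trans hWV)
    tauto

/-- The set `W` is what is left of `V` after vertices that won `w` constraints in total have been
removed from the end of the ranking; the budget that remains for `W` is `k` minus the number of
settled constraints that were not won. -/
structure Peeled (r : ℕ) (s : Finset α → α) (V : Finset α) (k : ℕ) (W : Finset α) (w : ℕ) :
    Prop where
  subset : W ⊆ V
  le_settled : w ≤ #(settled r V W)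
  isYesOn_iff : IsYesOn r s V k ↔
    #(settled r V W) ≤ k + w ∧ IsYesOn r s W (k + w - #(settled r V W))

theorem Peeled.refl : Peeled r s W k W 0 where
  subset := Subset.rfl
  le_settled := Nat.zero_le _
  isYesOn_iff := by simp [settled_self]

theorem Peeled.erase (h : Peeled r s V k W w) (hr : 3 ≤ r) (hs : IsSelection r s V)
    (hW : 2 * k + r ≤ #W) (hv : v ∈ W) (hmax : ∀ u ∈ W, #(won r s W u) ≤ #(won r s W v)) :
    Peeled r s V k (W.erase v) (w + #(won r s W v)) := by
  have hsW := hs.mono h.subset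
  have hsettled := card_settled_erase (r := r) (by omega) h.subset hv
  have hwon := card_won_add_card_lost (by omega) hsW hv
  have hw := h.le_settled
  refine ⟨(erase_subset v W).trans h.subset, by omega, ?_⟩
  rw [h.isYesOn_iff, isYesOn_iff_erase hr hsW (by omega) hv hmax, ← and_assoc]
  have hbudget : k + w - #(settled r V W) - #(lost r s W v) =
      k + (w + #(won r s W v)) - #(settled r V (W.erase v)) := by omega
  rw [hbudget]
  exact and_congr_left' (by omega)

end Peeling

section Renaming

open Finset

variable {α β : Type*} [DecidableEq β] {r m : ℕ} {e : α → β} {U : Finset α}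

theorem isLast_image {g : β → ℕ} {S : Finset α} {v : α} (he : Set.InjOn e S) (hv : v ∈ S) :
    IsLast g (e v) (S.image e) ↔ IsLast (g ∘ e) v S := by
  simp only [IsLast, forall_mem_image, Function.comp_apply]
  exact forall₂_congr fun u hu => by rw [Ne, he.eq_iff hu hv]

theorem powersetCard_image (he : Set.InjOn e U) :
    (U.image e).powersetCard r = (U.powersetCard r).image (·.image e) := by
  ext T
  simp only [mem_powersetCard, subset_image_iff, mem_image]
  constructor
  · rintro ⟨⟨S, hS, rfl⟩, hT⟩
    exact ⟨S, ⟨hS, by rwa [card_image_of_injOn (he.mono hS)] at hT⟩, rfl⟩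
  · rintro ⟨S, ⟨hS, hr⟩, rfl⟩
    exact ⟨⟨S, hS, rfl⟩, by rwa [card_image_of_injOn (he.mono hS)]⟩

variable {s : Finset α → α} {s' : Finset β → β}

theorem IsSelection.image (hs : IsSelection r s U) (he : Set.InjOn e U)
    (hs' : ∀ S ∈ U.powersetCard r, s' (S.image e) = e (s S)) : IsSelection r s' (U.image e) := by
  rw [IsSelection, powersetCard_image he, forall_mem_image]
  exact fun S hS => by rw [hs' S hS]; exact mem_image_of_mem e (hs S hS)

variable [DecidableEq α]

theorem card_violated_image {g : β → ℕ} (he : Set.InjOn e U) (hs : IsSelection r s U)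
    (hs' : ∀ S ∈ U.powersetCard r, s' (S.image e) = e (s S)) :
    #(violated r s' g (U.image e)) = #(violated r s (g ∘ e) U) := by
  have himage : violated r s' g (U.image e) = (violated r s (g ∘ e) U).image (·.image e) := by
    rw [violated, powersetCard_image he, filter_image, violated]
    refine congrArg _ (filter_congr fun S hS => not_congr ?_)
    rw [hs' S hS, isLast_image (he.mono (mem_powersetCard.1 hS).1) (hs S hS)]
  rw [himage, card_image_of_injOn]
  exact (image_injOn_powerset_of_injOn he).mono fun S hS =>
    mem_powerset.2 (mem_powersetCard.1 (mem_filter.1 hS).1).1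

theorem isYesOn_image (he : Set.InjOn e U) (hs : IsSelection r s U)
    (hs' : ∀ S ∈ U.powersetCard r, s' (S.image e) = e (s S)) :
    IsYesOn r s' (U.image e) m ↔ IsYesOn r s U m := by
  constructor
  · rintro ⟨g, hg, hm⟩
    refine ⟨g ∘ e, hg.comp he fun u hu => mem_coe.2 (mem_image_of_mem e hu), ?_⟩
    rwa [← card_violated_image he hs hs']
  · rintro ⟨g, hg, hm⟩
    obtain ⟨g', hg'⟩ : ∃ g' : β → ℕ, ∀ u ∈ U, (g' ∘ e) u = g u :=
      ⟨Function.extend ((U : Set α).domRestrict e) ((U : Set α).domRestrict g) 0, fun u hu =>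
        he.injective.extend_apply ((U : Set α).domRestrict g) 0 ⟨u, hu⟩⟩
    refine ⟨g', ?_, ?_⟩
    · rw [coe_image]
      exact (hg.congr fun u hu => (hg' u hu).symm).image_of_comp
    · rwa [card_violated_image he hs hs', violated_congr hs hg']

end Renaming

/-! ## Encodings of instances -/

section Blocks

variable {α β : Type*} {r n : ℕ} {l : List ℕ}

theorem sublistsLen_filter (p : α → Bool) (r : ℕ) (l : List α) :
    (l.filter p).sublistsLen r = (l.sublistsLen r).filter fun t => t.all p := by
  induction l generalizing r with
  | nil => cases r <;> simp [List.sublistsLen_zero, List.filter_cons]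
  | cons a l ih =>
    cases r with
    | zero => simp [List.sublistsLen_zero, List.filter_cons]
    | succ r =>
      rw [List.sublistsLen_succ_cons, List.filter_append, List.filter_map, ← ih]
      by_cases ha : p a
      · simp [ha, ih r, Function.comp_def]
      · simp [ha, Function.comp_def]

theorem sublistsLen_map (f : α → β) (r : ℕ) (l : List α) :
    (l.map f).sublistsLen r = (l.sublistsLen r).map (List.map f) := by
  induction l generalizing r with
  | nil => cases r <;> simp [List.sublistsLen_zero]
  | cons a l ih =>
    cases r with
    | zero => simp [List.sublistsLen_zero]
    | succ r => simp [List.sublistsLen_succ_cons, ih, Function.comp_def]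

/-- The constraints on the vertices `0, …, n - 1` as increasing lists, in the order in which an
encoded instance lists them. -/
abbrev blocks (r n : ℕ) : List (List ℕ) :=
  (List.range n).sublistsLen r

theorem nodup_of_mem_blocks (hl : l ∈ blocks r n) : l.Nodup :=
  List.nodup_range.sublist (List.mem_sublistsLen.1 hl).1

theorem toFinset_mem_powersetCard (hl : l ∈ blocks r n) :
    l.toFinset ∈ (Finset.range n).powersetCard r := by
  obtain ⟨hsub, hlen⟩ := List.mem_sublistsLen.1 hl
  rw [Finset.mem_powersetCard, List.toFinset_card_of_nodup (nodup_of_mem_blocks hl)]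
  exact ⟨fun x hx => by simpa using hsub.subset (List.mem_toFinset.1 hx), hlen⟩

theorem card_powersetCard_range_filter (r n : ℕ) (p : Finset ℕ → Prop) [DecidablePred p] :
    (((Finset.range n).powersetCard r).filter p).card =
      (blocks r n).countP fun l => p l.toFinset := by
  have hblocks : ((Finset.range n).powersetCard r).val.map Finset.val =
      ((blocks r n).map (↑) : List (Multiset ℕ)) := by
    rw [Finset.map_val_val_powersetCard, Finset.range_val, ← Multiset.coe_range,
      Multiset.powersetCard_coe]
  have hcount := congrArg (Multiset.countP fun t => p t.toFinset) hblocks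
  rw [Multiset.countP_map, Multiset.coe_countP, List.countP_map] at hcount
  have hval : ((Finset.range n).powersetCard r).filter p =
      ((Finset.range n).powersetCard r).filter fun S => p S.val.toFinset :=
    Finset.filter_congr fun S _ => by rw [Finset.val_toFinset]
  rw [hval]
  exact hcount

end Blocks

section Encoding

open Finset

variable {r n k : ℕ} {s : Finset ℕ → ℕ}

theorem powersetCard_range_eq_image (r n : ℕ) :
    (range n).powersetCard r =
      (univ : Finset (Constraint r n)).image fun S => S.1.image Fin.val := by
  have hrange : range n = (univ : Finset (Fin n)).image Fin.val := by ext; simp [Fin.exists_iff]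
  rw [hrange, powersetCard_image Fin.val_injective.injOn]
  ext S
  simp

theorem image_val_mem_powersetCard (S : Constraint r n) :
    S.1.image Fin.val ∈ (range n).powersetCard r := by
  rw [powersetCard_range_eq_image]
  exact mem_image_of_mem _ (mem_univ S)

/-- The selected vertices of an instance as numbers, for sets of numbers. -/
def Instance.selNat (R : Instance r) (S : Finset ℕ) : ℕ :=
  R.selVal {i | (i : ℕ) ∈ S}

theorem Instance.selNat_image (R : Instance r) (S : Constraint r R.n) :
    R.selNat (S.1.image Fin.val) = R.sel S := by
  have hS : ({i | (i : ℕ) ∈ S.1.image Fin.val} : Finset (Fin R.n)) = S.1 := by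
    ext
    simp [Fin.val_inj]
  rw [selNat, hS, selVal, dif_pos S.2]

theorem Instance.isSelection_selNat (R : Instance r) : IsSelection r R.selNat (range R.n) := by
  rw [IsSelection, powersetCard_range_eq_image, forall_mem_image]
  intro S _
  rw [R.selNat_image]
  exact mem_image_of_mem _ (R.sel_mem S)

/-- The encoding of the instance on `0, …, n - 1` with selected vertices `s`. -/
def encodeSel (r n k : ℕ) (s : Finset ℕ → ℕ) : List ℕ :=
  n :: k :: (blocks r n).flatMap fun l => l ++ [s l.toFinset]

theorem Instance.encode_eq (R : Instance r) : R.encode = encodeSel r R.n R.k R.selNat := by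
  have hsel (l : List (Fin R.n)) : R.selNat (l.map Fin.val).toFinset = R.selVal l.toFinset := by
    rw [selNat]
    congr 1
    ext
    simp [Fin.val_inj]
  rw [encode, encodeSel, blocks, ← List.map_coe_finRange_eq_range, sublistsLen_map,
    List.flatMap_map]
  simp only [hsel]

theorem Instance.cost_eq (R : Instance r) (σ : Ranking R.n) {g : ℕ → ℕ}
    (hg : ∀ i j : Fin R.n, σ i < σ j ↔ g i < g j) :
    R.cost σ = #(violated r R.selNat g (range R.n)) := by
  have hinj : Function.Injective fun S : Constraint r R.n => S.1.image Fin.val :=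
    (image_injective Fin.val_injective).comp Subtype.val_injective
  have hlast (S : Constraint r R.n) : IsLast σ (R.sel S) S.1 ↔
      IsLast g (R.selNat (S.1.image Fin.val)) (S.1.image Fin.val) := by
    rw [R.selNat_image, isLast_image Fin.val_injective.injOn (R.sel_mem S)]
    simp only [IsLast, hg, Function.comp_apply]
  rw [violated, powersetCard_range_eq_image, filter_image, card_image_of_injective _ hinj,
    card_filter]
  refine sum_congr rfl fun S _ => ?_
  simp only [c, ite_not, ← hlast]

theorem Instance.isYes_iff (R : Instance r) :
    R.IsYes ↔ IsYesOn r R.selNat (range R.n) R.k := by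
  constructor
  · rintro ⟨σ, hσ⟩
    obtain ⟨g, hg⟩ : ∃ g : ℕ → ℕ, ∀ i : Fin R.n, g i = σ i :=
      ⟨Function.extend Fin.val (fun i => (σ i : ℕ)) 0, fun i =>
        Fin.val_injective.extend_apply _ _ i⟩
    refine ⟨g, fun x hx y hy hxy => ?_, ?_⟩
    · lift x to Fin R.n using by simpa using hx
      lift y to Fin R.n using by simpa using hy
      rw [hg, hg] at hxy
      rw [σ.injective (Fin.val_injective hxy)]
    · rwa [← R.cost_eq σ fun i j => by rw [hg, hg, Fin.val_fin_lt]]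
  · rintro ⟨g, hg, hcost⟩
    let f : Fin R.n → ℕ := g ∘ Fin.val
    have hf : Function.Injective f := fun i j hij =>
      Fin.val_injective (hg (by simp) (by simp) hij)
    have hmono : StrictMono (f ∘ Tuple.sort f) :=
      (Tuple.monotone_sort f).strictMono_of_injective (hf.comp (Tuple.sort f).injective)
    refine ⟨(Tuple.sort f)⁻¹, ?_⟩
    rwa [R.cost_eq (g := g) _ fun i j => by rw [← hmono.lt_iff_lt]; simp [f]]

/-- The instance on `0, …, n - 1` with selected vertices `s`. -/
def Instance.ofSel (n k : ℕ) (s : Finset ℕ → ℕ) (hs : IsSelection r s (range n)) :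
    Instance r where
  n := n
  sel S := ⟨s (S.1.image Fin.val), by
    have hS := image_val_mem_powersetCard S
    exact mem_range.1 ((mem_powersetCard.1 hS).1 (hs _ hS))⟩
  sel_mem S := by
    obtain ⟨i, hi, his⟩ := mem_image.1 (hs _ (image_val_mem_powersetCard S))
    convert hi
    exact his.symm
  k := k

theorem Instance.selNat_ofSel (hs : IsSelection r s (range n)) :
    ∀ S ∈ (range n).powersetCard r, (ofSel n k s hs).selNat S = s S := by
  rw [powersetCard_range_eq_image, forall_mem_image]
  exact fun S _ => (ofSel n k s hs).selNat_image S

theorem Instance.encode_ofSel (hs : IsSelection r s (range n)) :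
    (ofSel n k s hs).encode = encodeSel r n k s := by
  rw [encode_eq, encodeSel, encodeSel]
  exact congrArg (fun t => n :: k :: t) <| List.flatMap_congr fun l hl => by
    rw [selNat_ofSel hs _ (toFinset_mem_powersetCard hl)]

theorem Instance.isYes_ofSel (hs : IsSelection r s (range n)) :
    (ofSel n k s hs).IsYes ↔ IsYesOn r s (range n) k := by
  have hsel := selNat_ofSel (k := k) hs
  exact (isYes_iff _).trans ⟨.congr hsel, .congr fun S hS => (hsel S hS).symm⟩

end Encoding

section Conflict

open Finset

variable {r : ℕ}

/-- A selection on the vertices `0, …, r` that no ranking respects: `0` has to precede `2` in the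
constraint without `1`, and `2` has to precede `0` in the constraint without `3`. -/
def conflictSel (S : Finset ℕ) : ℕ :=
  if 1 ∈ S then if 0 ∈ S then 0 else 1 else 2

theorem isSelection_conflictSel (hr : 2 ≤ r) : IsSelection r conflictSel (range (r + 1)) := by
  intro S hS
  rw [conflictSel]
  split_ifs with h1 h0
  · exact h0
  · exact h1
  · by_contra h2
    obtain ⟨hsub, hcard⟩ := mem_powersetCard.1 hS
    have := card_le_card (subset_erase.2 ⟨subset_erase.2 ⟨hsub, h1⟩, h2⟩)
    rw [card_erase_of_mem (by simp; omega), card_erase_of_mem (by simp; omega), card_range,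
      hcard] at this
    omega

theorem not_isYesOn_conflictSel (hr : 3 ≤ r) :
    ¬ IsYesOn r conflictSel (range (r + 1)) 0 := by
  rintro ⟨g, -, hg⟩
  have hlast : ∀ a < r + 1,
      IsLast g (conflictSel ((range (r + 1)).erase a)) ((range (r + 1)).erase a) := by
    intro a ha
    rw [Nat.le_zero, card_eq_zero, violated, filter_eq_empty_iff] at hg
    refine not_not.1 (hg (mem_powersetCard.2 ⟨erase_subset _ _, ?_⟩))
    rw [card_erase_of_mem (mem_range.2 ha), card_range, Nat.add_sub_cancel]
  have h02 : g 0 < g 2 := by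
    simpa [conflictSel] using hlast 1 (by omega) 0 (by simp) (by simp [conflictSel])
  have h20 : g 2 < g 0 := by
    have hsel : conflictSel ((range (r + 1)).erase 3) = 0 := by simp [conflictSel]; omega
    simpa [hsel] using hlast 3 (by omega) 2 (by simp; omega) (by simp [hsel])
  omega

theorem Instance.exists_not_isYes (hr : 3 ≤ r) :
    ∃ N : Instance r, N.n = r + 1 ∧ N.k = 0 ∧ ¬ N.IsYes :=
  ⟨ofSel (r + 1) 0 conflictSel (isSelection_conflictSel (by omega)), rfl, rfl,
    (isYes_ofSel _).not.2 (not_isYesOn_conflictSel hr)⟩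

end Conflict

section Restriction

open Finset

variable {r n : ℕ} {s : Finset ℕ → ℕ} {W S : Finset ℕ}

theorem map_count_filter_range (p : ℕ → Prop) [DecidablePred p] (n : ℕ) :
    ((List.range n).filter p).map (Nat.count p) = List.range (Nat.count p n) := by
  induction n with
  | zero => simp
  | succ n ih =>
    rw [List.range_succ, List.filter_append, List.map_append, ih, Nat.count_succ]
    by_cases h : p n <;> simp [h, List.range_succ]

theorem count_mem_eq_card (hW : W ⊆ range n) : Nat.count (· ∈ W) n = #W := by
  rw [Nat.count_eq_card_filter_range, filter_mem_eq_inter, inter_eq_right.2 hW]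

theorem injOn_count_mem : Set.InjOn (Nat.count (· ∈ W)) W :=
  fun _ hx _ hy => Nat.count_injective hx hy

theorem image_count_mem : W.image (Nat.count (· ∈ W)) = range #W := by
  refine eq_of_subset_of_card_le (image_subset_iff.2 fun v hv => ?_) ?_
  · simpa using Nat.count_lt_card (p := (· ∈ W)) W.finite_toSet hv
  · rw [card_image_of_injOn injOn_count_mem, card_range]

theorem image_nth_image_count (hS : S ⊆ W) :
    (S.image (Nat.count (· ∈ W))).image (Nat.nth (· ∈ W)) = S := by
  rw [image_image]
  exact (image_congr fun v hv => Nat.nth_count (p := (· ∈ W)) (hS hv)).trans image_id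

/-- The selection on `0, …, #W - 1` that arises from a selection on `W` when the vertices in `W`
are renamed in increasing order. -/
noncomputable def restrictSel (s : Finset ℕ → ℕ) (W S : Finset ℕ) : ℕ :=
  Nat.count (· ∈ W) (s (S.image (Nat.nth (· ∈ W))))

theorem restrictSel_image (hS : S ⊆ W) :
    restrictSel s W (S.image (Nat.count (· ∈ W))) = Nat.count (· ∈ W) (s S) := by
  rw [restrictSel, image_nth_image_count hS]

theorem isSelection_restrictSel (hs : IsSelection r s W) :
    IsSelection r (restrictSel s W) (range #W) :=
  image_count_mem ▸ hs.image injOn_count_mem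
    fun _ hS => restrictSel_image (mem_powersetCard.1 hS).1

/-- The restriction of an instance to the vertices in `W`, with parameter `k`. -/
noncomputable def Instance.restriction (R : Instance r) (W : Finset ℕ) (hW : W ⊆ range R.n)
    (k : ℕ) : Instance r :=
  ofSel #W k (restrictSel R.selNat W) (isSelection_restrictSel (R.isSelection_selNat.mono hW))

variable {R : Instance r}

theorem Instance.isYes_restriction (hW : W ⊆ range R.n) (k : ℕ) :
    (R.restriction W hW k).IsYes ↔ IsYesOn r R.selNat W k := by
  rw [restriction, isYes_ofSel, ← image_count_mem]
  exact isYesOn_image injOn_count_mem (R.isSelection_selNat.mono hW)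
    fun S hS => restrictSel_image (mem_powersetCard.1 hS).1

theorem Instance.encode_restriction (hW : W ⊆ range R.n) (k : ℕ) :
    (R.restriction W hW k).encode = #W :: k ::
      ((blocks r R.n).filter (·.toFinset ⊆ W)).flatMap fun l =>
        l.map (Nat.count (· ∈ W)) ++ [Nat.count (· ∈ W) (R.selNat l.toFinset)] := by
  have hblocks : blocks r #W =
      ((blocks r R.n).filter (·.toFinset ⊆ W)).map (List.map (Nat.count (· ∈ W))) := by
    rw [blocks, ← count_mem_eq_card hW, ← map_count_filter_range, sublistsLen_map,
      sublistsLen_filter]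
    congr 2
    ext l
    rw [Bool.eq_iff_iff]
    simp [subset_iff]
  rw [restriction, encode_ofSel, encodeSel, hblocks, List.flatMap_map]
  refine congrArg (fun t => #W :: k :: t) <| List.flatMap_congr fun l hl => ?_
  have hlW : l.toFinset ⊆ W := by simpa using (List.mem_filter.1 hl).2
  have himage : (l.map (Nat.count (· ∈ W))).toFinset = l.toFinset.image (Nat.count (· ∈ W)) := by
    ext
    simp
  rw [himage, restrictSel_image hlW]

end Restriction

end DenseFAS

/-! ## Specifications of programs -/

namespace RAM

variable {p q : Prog} {e : Expr} {s s₁ s₂ s₃ : Store} {Q Q' : Store → Prop} {T T' N : ℕ}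
  {xs as ys bs : List ℕ}

/-- The stores agree except possibly in the registers `xs` and the arrays `as`. -/
structure Store.EqOff (xs as : List ℕ) (s s' : Store) : Prop where
  var : ∀ x ∉ xs, s'.var x = s.var x
  arr : ∀ a ∉ as, s'.arr a = s.arr a

theorem Store.EqOff.refl (s : Store) : EqOff xs as s s := ⟨fun _ _ => rfl, fun _ _ => rfl⟩

theorem Store.EqOff.trans (h : EqOff xs as s₁ s₂) (h' : EqOff xs as s₂ s₃) : EqOff xs as s₁ s₃ :=
  ⟨fun x hx => (h'.var x hx).trans (h.var x hx), fun a ha => (h'.arr a ha).trans (h.arr a ha)⟩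

/-- The store after an assignment to a register. -/
def Store.setVar (s : Store) (x m : ℕ) : Store :=
  { s with var := Function.update s.var x m }

/-- The store after a write to an array. -/
def Store.setArr (s : Store) (a i m : ℕ) : Store :=
  { s with arr := Function.update s.arr a (Function.update (s.arr a) i m) }

@[simp] theorem Store.setVar_var (s : Store) (x m y : ℕ) :
    (s.setVar x m).var y = if y = x then m else s.var y :=
  Function.update_apply _ _ _ _

@[simp] theorem Store.setVar_arr (s : Store) (x m : ℕ) : (s.setVar x m).arr = s.arr := rfl

@[simp] theorem Store.setArr_var (s : Store) (a i m : ℕ) : (s.setArr a i m).var = s.var := rfl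

theorem Store.setArr_arr_self (s : Store) (a i m j : ℕ) :
    (s.setArr a i m).arr a j = if j = i then m else s.arr a j := by
  simp [setArr, Function.update_apply]

theorem Store.eqOff_setVar {x : ℕ} (hx : x ∈ xs) (m : ℕ) : EqOff xs as s (s.setVar x m) :=
  ⟨fun _ hy => Function.update_of_ne (ne_of_mem_of_not_mem hx hy).symm _ _, fun _ _ => rfl⟩

theorem Store.eqOff_setArr {a : ℕ} (ha : a ∈ as) (i m : ℕ) : EqOff xs as s (s.setArr a i m) :=
  ⟨fun _ _ => rfl, fun _ hb => Function.update_of_ne (ne_of_mem_of_not_mem ha hb).symm _ _⟩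

/-- Every assignment in the program is to a register in `xs`, and every write to an array in `as`.
This syntactic condition yields the frame rule `Runs.eqOff`. -/
def Prog.Modifies (xs as : List ℕ) : Prog → Prop
  | .skip => True
  | .assign x _ => x ∈ xs
  | .write a _ _ => a ∈ as
  | .seq p q => p.Modifies xs as ∧ q.Modifies xs as
  | .cond _ p q => p.Modifies xs as ∧ q.Modifies xs as
  | .loop _ p => p.Modifies xs as

theorem Prog.Modifies.mono (hp : p.Modifies xs as) (hx : xs ⊆ ys) (ha : as ⊆ bs) :
    p.Modifies ys bs := by
  induction p with
  | skip => trivial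
  | assign => exact hx hp
  | write => exact ha hp
  | seq _ _ ihp ihq => exact ⟨ihp hp.1, ihq hp.2⟩
  | cond _ _ _ ihp ihq => exact ⟨ihp hp.1, ihq hp.2⟩
  | loop _ _ ih => exact ih hp

theorem Runs.eqOff {t : ℕ} (h : Runs p s₁ s₂ t) (hp : p.Modifies xs as) :
    Store.EqOff xs as s₁ s₂ := by
  induction h with
  | skip => exact .refl _
  | assign => exact Store.eqOff_setVar hp _
  | write => exact Store.eqOff_setArr hp _ _
  | seq _ _ ih ih' => exact (ih hp.1).trans (ih' hp.2)
  | cond_true _ _ ih => exact ih hp.1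
  | cond_false _ _ ih => exact ih hp.2
  | loop_done => exact .refl _
  | loop_step _ _ _ ih ih' => exact (ih hp).trans (ih' hp)

/-- Started in `s`, the program `p` halts after at most `T` steps in a store that satisfies `Q`. -/
def Exec (p : Prog) (s : Store) (T : ℕ) (Q : Store → Prop) : Prop :=
  ∃ (s' : Store) (t : ℕ), Runs p s s' t ∧ t ≤ T ∧ Q s'

theorem Exec.mono (h : Exec p s T Q) (hT : T ≤ T') (hQ : ∀ s', Q s' → Q' s') : Exec p s T' Q' := by
  obtain ⟨s', t, hrun, ht, hs'⟩ := h
  exact ⟨s', t, hrun, ht.trans hT, hQ s' hs'⟩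

theorem Exec.mono_time (h : Exec p s T Q) (hT : T ≤ T') : Exec p s T' Q :=
  h.mono hT fun _ => id

theorem Exec.skip (h : Q s) : Exec .skip s 1 Q := ⟨s, 1, .skip s, le_rfl, h⟩

theorem Exec.assign {x : ℕ} (h : Q (s.setVar x (e.eval s))) : Exec (.assign x e) s 1 Q :=
  ⟨_, 1, .assign s x e, le_rfl, h⟩

theorem Exec.write {a : ℕ} {i : Expr} (h : Q (s.setArr a (i.eval s) (e.eval s))) :
    Exec (.write a i e) s 1 Q :=
  ⟨_, 1, .write s a i e, le_rfl, h⟩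

theorem Exec.seq (h : Exec p s T fun s' => Exec q s' T' Q) : Exec (.seq p q) s (T + T') Q := by
  obtain ⟨s', t, hrun, ht, s'', t', hrun', ht', hQ⟩ := h
  exact ⟨s'', t + t', .seq hrun hrun', add_le_add ht ht', hQ⟩

theorem Exec.seq_of_modifies (hp : p.Modifies xs as) (h : Exec p s T Q)
    (h' : ∀ s', Store.EqOff xs as s s' → Q s' → Exec q s' T' Q') :
    Exec (.seq p q) s (T + T') Q' := by
  obtain ⟨s', t, hrun, ht, hQ⟩ := h
  exact Exec.seq ⟨s', t, hrun, ht, h' s' (hrun.eqOff hp) hQ⟩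

theorem Exec.cond (hp : e.eval s ≠ 0 → Exec p s T Q) (hq : e.eval s = 0 → Exec q s T Q) :
    Exec (.cond e p q) s (T + 1) Q := by
  by_cases he : e.eval s = 0
  · obtain ⟨s', t, hrun, ht, hQ⟩ := hq he
    exact ⟨s', t + 1, .cond_false he hrun, Nat.succ_le_succ ht, hQ⟩
  · obtain ⟨s', t, hrun, ht, hQ⟩ := hp he
    exact ⟨s', t + 1, .cond_true he hrun, Nat.succ_le_succ ht, hQ⟩

theorem Exec.loop (I : ℕ → Store → Prop) (hp : p.Modifies xs as)
    (hdone : ∀ s', Store.EqOff xs as s s' → I N s' → e.eval s' = 0)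
    (hstep : ∀ i < N, ∀ s', Store.EqOff xs as s s' → I i s' →
      e.eval s' ≠ 0 ∧ Exec p s' T (I (i + 1)))
    (h0 : I 0 s) : Exec (.loop e p) s (N * (T + 1) + 1) (I N) := by
  suffices h : ∀ d i s', i + d = N → Store.EqOff xs as s s' → I i s' →
      Exec (.loop e p) s' (d * (T + 1) + 1) (I N) from h N 0 s (Nat.zero_add N) (.refl s) h0
  intro d
  induction d with
  | zero =>
    rintro i s' rfl hs' hI
    exact ⟨s', 1, .loop_done (hdone s' hs' hI), Nat.le_add_left _ _, hI⟩
  | succ d ih =>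
    intro i s' hi hs' hI
    obtain ⟨he, s'', t, hrun, ht, hI'⟩ := hstep i (by omega) s' hs' hI
    obtain ⟨s''', t', hrun', ht', hN⟩ :=
      ih (i + 1) s'' (by omega) (hs'.trans (hrun.eqOff hp)) hI'
    exact ⟨s''', t + t' + 1, .loop_step he hrun hrun', by rw [Nat.add_mul]; omega, hN⟩

/-- Run `p` with the register `x` equal to `a`, `a + d`, `a + 2 * d`, … as long as this is less than
the value of `e`. -/
def forLoop (x a d : ℕ) (e : Expr) (p : Prog) : Prog :=
  .seq (.assign x (.lit a))
    (.loop (.sub e (.var x)) (.seq p (.assign x (.add (.var x) (.lit d)))))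

theorem modifies_forLoop {x a d : ℕ} :
    (forLoop x a d e p).Modifies xs as ↔ x ∈ xs ∧ p.Modifies xs as := by
  simp only [forLoop, Prog.Modifies]
  tauto

theorem Exec.forLoop {x a d : ℕ} (I : ℕ → Store → Prop) (hd : 0 < d) (hp : p.Modifies xs as)
    (hx : x ∉ xs) (hI : ∀ i s' m, I i s' → I i (s'.setVar x m))
    (he : ∀ s', Store.EqOff (x :: xs) as s s' → e.eval s' = a + d * N)
    (hstep : ∀ i < N, ∀ s', Store.EqOff (x :: xs) as s s' → s'.var x = a + d * i → I i s' →
      Exec p s' T (I (i + 1)))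
    (h0 : I 0 s) : Exec (forLoop x a d e p) s (N * (T + 2) + 2) (I N) := by
  have hinit : Store.EqOff (x :: xs) as s (s.setVar x a) := Store.eqOff_setVar List.mem_cons_self a
  have hloop := Exec.loop (s := s.setVar x a) (e := .sub e (.var x)) (T := T + 1) (N := N)
    (p := .seq p (.assign x (.add (.var x) (.lit d)))) (xs := x :: xs) (as := as)
    (fun i s' => I i s' ∧ s'.var x = a + d * i) ?modifies ?done ?step ⟨hI _ _ _ h0, by simp⟩
  · refine (Exec.seq (T := 1) (Exec.assign (hloop.mono le_rfl fun _ h => h.1))).mono_time ?_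
    ring_nf
    omega
  case modifies =>
    exact ⟨hp.mono (List.subset_cons_self x xs) (List.Subset.refl as), List.mem_cons_self⟩
  case done =>
    rintro s' hs' ⟨-, hvar⟩
    rw [Expr.eval, he s' (hinit.trans hs'), Expr.eval, hvar, Nat.sub_self]
  case step =>
    rintro i hi s' hs' ⟨hIs', hvar⟩
    have hlt := Nat.mul_lt_mul_of_pos_left hi hd
    refine ⟨?_, Exec.seq_of_modifies hp (hstep i hi s' (hinit.trans hs') hvar hIs') ?_⟩
    · rw [Expr.eval, he s' (hinit.trans hs'), Expr.eval, hvar]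
      omega
    · refine fun s'' hs'' hIs'' => Exec.assign ⟨hI _ _ _ hIs'', ?_⟩
      rw [Store.setVar_var, if_pos rfl, Expr.eval, Expr.eval, Expr.eval, hs''.var x hx, hvar]
      ring

/-- The sum of a list of expressions. -/
def Expr.sum : List Expr → Expr
  | [] => .lit 0
  | e :: es => .add e (Expr.sum es)

theorem Expr.eval_sum_eq_zero {es : List Expr} :
    (Expr.sum es).eval s = 0 ↔ ∀ e ∈ es, e.eval s = 0 := by
  induction es with
  | nil => simp [Expr.sum, Expr.eval]
  | cons e es ih => simp [Expr.sum, Expr.eval, ih]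

/-- Append the value of `e` to the output. -/
def push (e : Expr) : Prog :=
  .seq (.write 0 (.var 0) e) (.assign 0 (.add (.var 0) (.lit 1)))

/-- Append the values of some expressions to the output. -/
def pushAll : List Expr → Prog
  | [] => .skip
  | e :: es => .seq (push e) (pushAll es)

theorem modifies_push : (push e).Modifies [0] [0] :=
  ⟨List.mem_cons_self, List.mem_cons_self⟩

theorem modifies_pushAll (es : List Expr) : (pushAll es).Modifies [0] [0] := by
  induction es with
  | nil => trivial
  | cons e es ih => exact ⟨modifies_push, ih⟩

theorem Store.EqOff.output_eq (h : EqOff xs as s₁ s₂) (hx : 0 ∉ xs := by decide)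
    (ha : 0 ∉ as := by decide) : s₂.output = s₁.output := by
  rw [output, output, h.var 0 hx, h.arr 0 ha]

theorem Exec.push : Exec (push e) s 2 fun s' => s'.output = s.output ++ [e.eval s] := by
  refine Exec.seq (T := 1) (T' := 1) (Exec.write (Exec.assign ?_))
  simp only [Store.output, Expr.eval, Store.setVar_var, Store.setArr_var, if_true, Store.setVar_arr,
    Store.setArr_arr_self, List.range_succ, List.map_append, List.map_cons, List.map_nil]
  congr 1
  exact List.map_congr_left fun i hi =>
    (Store.setArr_arr_self ..).trans (if_neg (List.mem_range.1 hi).ne)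

theorem Exec.pushAll {es : List Expr}
    (hes : ∀ e ∈ es, ∀ s', Store.EqOff [0] [0] s s' → e.eval s' = e.eval s) :
    Exec (pushAll es) s (2 * es.length + 1) fun s' =>
      s'.output = s.output ++ es.map (Expr.eval s) := by
  induction es generalizing s with
  | nil => exact Exec.skip (by simp)
  | cons e es ih =>
    refine (Exec.seq_of_modifies modifies_push Exec.push fun s₁ hs₁ hout =>
      (ih fun e' he' s₂ hs₂ => ?_).mono le_rfl fun s₂ hout' => ?_).mono_time ?_
    · rw [hes e' (List.mem_cons_of_mem _ he') _ (hs₁.trans hs₂),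
        hes e' (List.mem_cons_of_mem _ he') _ hs₁]
    · rw [hout', hout, List.map_cons, List.append_assoc, List.singleton_append]
      congr 2
      exact List.map_congr_left fun e' he' => hes e' (List.mem_cons_of_mem _ he') _ hs₁
    · rw [List.length_cons]
      omega

end RAM

/-! ## The kernelization program -/

namespace DenseFAS

open RAM Finset

section Layout

variable {r n k : ℕ} {s : Finset ℕ → ℕ} {l l₁ l₂ l₃ xs as : List ℕ} {σ σ' : Store}

/- The registers and arrays of the kernelization:
`x₀`: length of the output,  `x₁`: length of the input,  `x₂`: position in the input,
`x₃`: current vertex or position,  `x₄`: counter,  `x₅`: largest number of wins,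
`x₆`: a vertex with `x₅` wins,  `x₇`: wins of the removed vertices, each when it was removed,
`x₈`: number of remaining vertices,  `x₉`: number of settled constraints;
`A₀`: input and output,  `A₁`: flags of the removed vertices,  `A₂`: new names of the vertices,
`A₃`: copy of the input. -/

/-- The array `A₃` holds the list `l`, and the register `x₁` its length. -/
structure Loaded (l : List ℕ) (σ : Store) : Prop where
  length : σ.var 1 = l.length
  getD : ∀ i < l.length, σ.arr 3 i = l.getD i 0

theorem Loaded.congr (h : Loaded l σ) (hσ : Store.EqOff xs as σ σ') (hx : 1 ∉ xs := by decide)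
    (ha : 3 ∉ as := by decide) : Loaded l σ' :=
  ⟨(hσ.var 1 hx).trans h.length, fun i hi => by rw [hσ.arr 3 ha, h.getD i hi]⟩

theorem Loaded.map_range (h : Loaded (l₁ ++ l₂ ++ l₃) σ) :
    (List.range l₂.length).map (fun j => σ.arr 3 (l₁.length + j)) = l₂ := by
  refine List.ext_getElem (by simp) fun j _ hj => ?_
  have hlt : l₁.length + j < (l₁ ++ l₂).length := by simpa using hj
  rw [List.getElem_map, List.getElem_range, h.getD _ (by rw [List.length_append]; omega),
    List.getD_append _ _ _ _ hlt, List.getD_append_right _ _ _ _ (Nat.le_add_right _ _),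
    Nat.add_sub_cancel_left, List.getD_eq_getElem _ _ hj]

theorem Loaded.arr_zero (h : Loaded (encodeSel r n k s) σ) : σ.arr 3 0 = n := by
  rw [h.getD 0 (by simp [encodeSel]), encodeSel, List.getD_cons_zero]

theorem Loaded.arr_one (h : Loaded (encodeSel r n k s) σ) : σ.arr 3 1 = k := by
  rw [h.getD 1 (by simp [encodeSel]), encodeSel, List.getD_cons_succ, List.getD_cons_zero]

theorem length_blocks (r n : ℕ) : (blocks r n).length = n.choose r := by
  rw [List.length_sublistsLen, List.length_range]

theorem length_of_mem_blocks (hl : l ∈ blocks r n) : l.length = r :=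
  (List.mem_sublistsLen.1 hl).2

theorem length_flatMap_blocks {B : List (List ℕ)} (hB : ∀ l ∈ B, l.length = r) :
    (B.flatMap fun l => l ++ [s l.toFinset]).length = (r + 1) * B.length := by
  have hlen : ∀ l ∈ B, (l ++ [s l.toFinset]).length = r + 1 := fun l hl => by simp [hB l hl]
  rw [List.length_flatMap, List.map_congr_left hlen, List.map_const', List.sum_replicate,
    smul_eq_mul, mul_comm]

theorem length_encodeSel (r n k : ℕ) (s : Finset ℕ → ℕ) :
    (encodeSel r n k s).length = 2 + (r + 1) * n.choose r := by
  rw [encodeSel, List.length_cons, List.length_cons,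
    length_flatMap_blocks fun l => length_of_mem_blocks, length_blocks]
  ring

/-- The `j`-th entry of the block that starts at the position `x₂` of the input. Its last entry, the
selected vertex, is the one with `j = r`. -/
def entryExpr (j : ℕ) : Expr :=
  .get 3 (.add (.var 2) (.lit j))

/-- The block of the constraint `l` starts at the position `x₂` of the input. -/
def AtBlock (r : ℕ) (s : Finset ℕ → ℕ) (l : List ℕ) (σ : Store) : Prop :=
  (List.range (r + 1)).map (fun j => (entryExpr j).eval σ) = l ++ [s l.toFinset]

theorem AtBlock.map_entryExpr (h : AtBlock r s l σ) :
    (List.range r).map (fun j => (entryExpr j).eval σ) = l := by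
  rw [AtBlock, List.range_succ, List.map_append] at h
  exact (List.append_inj' h rfl).1

theorem AtBlock.eval_entryExpr (h : AtBlock r s l σ) : (entryExpr r).eval σ = s l.toFinset := by
  rw [AtBlock, List.range_succ, List.map_append] at h
  exact List.singleton_inj.1 (List.append_inj' h rfl).2

theorem Loaded.atBlock (h : Loaded (encodeSel r n k s) σ) {i : ℕ} (hi : i < (blocks r n).length)
    (hvar : σ.var 2 = 2 + (r + 1) * i) : AtBlock r s (blocks r n)[i] σ := by
  set f : List ℕ → List ℕ := fun l => l ++ [s l.toFinset] with hf
  have hsplit : encodeSel r n k s = n :: k :: ((blocks r n).take i).flatMap f ++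
      f (blocks r n)[i] ++ ((blocks r n).drop (i + 1)).flatMap f := by
    rw [List.append_assoc, List.cons_append, List.cons_append, ← List.flatMap_cons,
      ← List.flatMap_append, ← List.drop_eq_getElem_cons hi, List.take_append_drop, encodeSel]
  have hpos : (n :: k :: ((blocks r n).take i).flatMap f).length = σ.var 2 := by
    rw [List.length_cons, List.length_cons, hf,
      length_flatMap_blocks fun l hl => length_of_mem_blocks (List.mem_of_mem_take hl),
      List.length_take_of_le hi.le, hvar]
    ring
  have hlen : (f (blocks r n)[i]).length = r + 1 := by
    rw [List.length_append, length_of_mem_blocks (List.getElem_mem hi), List.length_singleton]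
  rw [hsplit] at h
  have hmap := h.map_range
  rw [hpos, hlen] at hmap
  exact hmap

end Layout

section Blocks

variable {r n k T : ℕ} {s : Finset ℕ → ℕ} {xs as : List ℕ} {σ : Store} {p : Prog}

/-- Run `p` with `x₂` at each block of the input. -/
def forBlocks (r : ℕ) (p : Prog) : Prog :=
  forLoop 2 2 (r + 1) (.var 1) p

theorem exec_forBlocks (I : List (List ℕ) → Store → Prop) (hl : Loaded (encodeSel r n k s) σ)
    (hp : p.Modifies xs as) (hx : 1 ∉ xs) (hx' : 2 ∉ xs) (ha : 3 ∉ as)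
    (hI : ∀ B σ' m, I B σ' → I B (σ'.setVar 2 m))
    (hstep : ∀ B, ∀ l ∈ blocks r n, ∀ σ', Store.EqOff (2 :: xs) as σ σ' → AtBlock r s l σ' →
      I B σ' → Exec p σ' T (I (B ++ [l])))
    (h0 : I [] σ) : Exec (forBlocks r p) σ (n.choose r * (T + 2) + 2) (I (blocks r n)) := by
  have hl' (σ' : Store) (hσ' : Store.EqOff (2 :: xs) as σ σ') : Loaded (encodeSel r n k s) σ' :=
    hl.congr hσ' (by simp [hx]) ha
  have hrun := Exec.forLoop (a := 2) (d := r + 1) (e := .var 1) (N := n.choose r) (T := T)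
    (fun i => I ((blocks r n).take i)) r.succ_pos hp hx' (fun i => hI _)
    (fun σ' hσ' => (hl' σ' hσ').length.trans (length_encodeSel r n k s)) ?_ h0
  · rw [← length_blocks, List.take_length] at hrun
    rwa [← length_blocks]
  · intro i hi σ' hσ' hvar hIσ'
    rw [← length_blocks] at hi
    rw [← List.take_concat_get' _ _ hi]
    exact hstep _ _ (List.getElem_mem hi) σ' hσ' ((hl' σ' hσ').atBlock hi hvar) hIσ'

/-- Let `x` be the number of blocks for which `e` has the value `0`. -/
def countBlocks (r x : ℕ) (e : Expr) : Prog :=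
  .seq (.assign x (.lit 0))
    (forBlocks r (.cond e .skip (.assign x (.add (.var x) (.lit 1)))))

theorem modifies_countBlocks (r x : ℕ) (e : Expr) : (countBlocks r x e).Modifies [2, x] [] := by
  simp [countBlocks, forBlocks, modifies_forLoop, Prog.Modifies]

theorem exec_countBlocks {x : ℕ} {e : Expr} {P : Finset ℕ → Prop} [DecidablePred P]
    (hl : Loaded (encodeSel r n k s) σ) (hx : x ≠ 1) (hx' : x ≠ 2)
    (he : ∀ l ∈ blocks r n, ∀ σ', Store.EqOff [2, x] [] σ σ' → AtBlock r s l σ' →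
      (e.eval σ' = 0 ↔ P l.toFinset)) :
    Exec (countBlocks r x e) σ (4 * n.choose r + 3) fun σ' =>
      σ'.var x = #{S ∈ (range n).powersetCard r | P S} := by
  have hinit : Store.EqOff [2, x] [] σ (σ.setVar x 0) := Store.eqOff_setVar (by simp) 0
  rw [card_powersetCard_range_filter]
  refine (Exec.seq (T := 1) (Exec.assign (exec_forBlocks (T := 2) (xs := [x]) (as := [])
    (fun B σ' => σ'.var x = B.countP fun l => P l.toFinset)
    (hl.congr hinit (by simp [hx.symm]) (by simp)) (by simp [Prog.Modifies]) (by simp [hx.symm])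
    (by simp [hx'.symm]) (by simp) ?_ ?_ (by simp [Expr.eval])))).mono_time (by omega)
  · intro B σ' m hB
    simpa [hx'] using hB
  · intro B l hlmem σ' hσ' hat hB
    have hiff := he l hlmem σ' (hinit.trans hσ') hat
    rw [List.countP_append, List.countP_singleton, ← hB]
    refine Exec.cond (T := 1) (fun hne => Exec.skip ?_) (fun h0 => Exec.assign ?_)
    · simp [← hiff, hne]
    · simp [← hiff, h0, Expr.eval]

end Blocks

section Peel

variable {r n k i w : ℕ} {s : Finset ℕ → ℕ} {W : Finset ℕ} {l xs as : List ℕ} {σ σ' : Store}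
  {f : ℕ → ℕ}

/-- The vertices in `W` remain; the other ones have been removed, with `w` wins in total. -/
structure Remaining (n : ℕ) (W : Finset ℕ) (w : ℕ) (σ : Store) : Prop where
  flag : ∀ v < n, σ.arr 1 v = if v ∈ W then 0 else 1
  wins : σ.var 7 = w
  card : σ.var 8 = #W

theorem Remaining.congr (h : Remaining n W w σ) (hσ : Store.EqOff xs as σ σ')
    (hx : 7 ∉ xs := by decide) (hx' : 8 ∉ xs := by decide) (ha : 1 ∉ as := by decide) :
    Remaining n W w σ' :=
  ⟨fun v hv => by rw [hσ.arr 1 ha, h.flag v hv], (hσ.var 7 hx).trans h.wins,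
    (hσ.var 8 hx').trans h.card⟩

/-- The number of removed vertices in the block at `x₂`, which is `0` unless the constraint is
settled. -/
def settledExpr (r : ℕ) : Expr :=
  Expr.sum ((List.range r).map fun j => .get 1 (entryExpr j))

theorem eval_settledExpr (hrem : Remaining n W w σ) (hl : l ∈ blocks r n) (hat : AtBlock r s l σ) :
    (settledExpr r).eval σ = 0 ↔ l.toFinset ⊆ W := by
  have hlt (v : ℕ) (hv : v ∈ l) : v < n := by
    simpa using (mem_powersetCard.1 (toFinset_mem_powersetCard hl)).1 (List.mem_toFinset.2 hv)
  have heval : (settledExpr r).eval σ = 0 ↔ ∀ v ∈ l, σ.arr 1 v = 0 := by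
    rw [settledExpr, Expr.eval_sum_eq_zero, ← hat.map_entryExpr, List.forall_mem_map,
      List.forall_mem_map]
    rfl
  rw [heval, subset_iff]
  refine forall_congr' fun v => ?_
  rw [List.mem_toFinset]
  refine imp_congr_right fun hv => ?_
  rw [hrem.flag v (hlt v hv), ite_eq_left_iff]
  simp

/-- Let `x₄` be the number of wins of the vertex `x₃`. -/
def countWins (r : ℕ) : Prog :=
  countBlocks r 4 (.add (settledExpr r)
    (.add (.sub (entryExpr r) (.var 3)) (.sub (.var 3) (entryExpr r))))

theorem modifies_countWins (r : ℕ) : (countWins r).Modifies [2, 4] [] :=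
  modifies_countBlocks _ _ _

theorem won_eq_filter (hW : W ⊆ range n) (v : ℕ) :
    won r s W v = {S ∈ (range n).powersetCard r | S ⊆ W ∧ s S = v} := by
  ext S
  simp only [won, mem_filter, mem_powersetCard]
  exact ⟨fun ⟨⟨hS, hcard⟩, hsel⟩ => ⟨⟨hS.trans hW, hcard⟩, hS, hsel⟩,
    fun ⟨⟨_, hcard⟩, hS, hsel⟩ => ⟨⟨hS, hcard⟩, hsel⟩⟩

theorem exec_countWins (hl : Loaded (encodeSel r n k s) σ) (hrem : Remaining n W w σ)
    (hW : W ⊆ range n) :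
    Exec (countWins r) σ (4 * n.choose r + 3) fun σ' => σ'.var 4 = #(won r s W (σ.var 3)) := by
  rw [won_eq_filter hW]
  refine exec_countBlocks hl (by decide) (by decide) fun l hlmem σ' hσ' hat => ?_
  rw [← eval_settledExpr (hrem.congr hσ') hlmem hat, ← hat.eval_entryExpr]
  simp only [Expr.eval, hσ'.var 3 (by decide)]
  omega

/-- The register `x₅` holds the maximum of `0` and of the values of `f` below `i`; unless it is `0`,
the value is attained at `x₆`. -/
structure MaxRecorded (f : ℕ → ℕ) (i : ℕ) (σ : Store) : Prop where
  le : ∀ u < i, f u ≤ σ.var 5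
  attained : σ.var 5 ≠ 0 → f (σ.var 6) = σ.var 5

/-- If `x₄`, the value at `x₃`, exceeds the maximum in `x₅`, record it. -/
def recordMax : Prog :=
  .cond (.sub (.var 4) (.var 5)) (.seq (.assign 5 (.var 4)) (.assign 6 (.var 3))) .skip

theorem exec_recordMax (h : MaxRecorded f i σ) (h3 : σ.var 3 = i) (h4 : σ.var 4 = f i) :
    Exec recordMax σ 3 (MaxRecorded f (i + 1)) := by
  refine Exec.cond (T := 2) (fun hlt => Exec.seq (T := 1) (Exec.assign (Exec.assign ⟨?_, ?_⟩)))
    (fun hle => (Exec.skip ⟨?_, h.attained⟩).mono_time one_le_two)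
  · intro u hu
    simp only [Expr.eval, h4] at hlt
    obtain hu | rfl := Nat.lt_succ_iff_lt_or_eq.1 hu
    · have := h.le u hu
      simp [Expr.eval, h4]
      omega
    · simp [Expr.eval, h4]
  · simp [Expr.eval, h3, h4]
  · intro u hu
    obtain hu | rfl := Nat.lt_succ_iff_lt_or_eq.1 hu
    · exact h.le u hu
    · simpa [Expr.eval, h4, Nat.sub_eq_zero_iff_le] using hle

/-- Let `x₆` be a vertex with the largest number of wins, and `x₅` this number. -/
def argmaxWins (r : ℕ) : Prog :=
  .seq (.assign 5 (.lit 0))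
    (forLoop 3 0 1 (.get 3 (.lit 0)) (.seq (countWins r) recordMax))

theorem modifies_seq_recordMax (r : ℕ) :
    (Prog.seq (countWins r) recordMax).Modifies [2, 4, 5, 6] [] :=
  ⟨(modifies_countWins r).mono (by decide) (by decide), by simp [recordMax, Prog.Modifies]⟩

theorem modifies_argmaxWins (r : ℕ) : (argmaxWins r).Modifies [3, 2, 4, 5, 6] [] :=
  ⟨by simp [Prog.Modifies], modifies_forLoop.2
    ⟨by decide, (modifies_seq_recordMax r).mono (by decide) (by decide)⟩⟩

theorem exec_argmaxWins (hl : Loaded (encodeSel r n k s) σ) (hrem : Remaining n W w σ)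
    (hW : W ⊆ range n) :
    Exec (argmaxWins r) σ (n * (4 * n.choose r + 8) + 3)
      (MaxRecorded (fun u => #(won r s W u)) n) := by
  have hinit : Store.EqOff [3, 2, 4, 5, 6] [] σ (σ.setVar 5 0) :=
    Store.eqOff_setVar (by decide) 0
  refine (Exec.seq (T := 1) (Exec.assign (Exec.forLoop (N := n) (T := 4 * n.choose r + 6)
    (MaxRecorded fun u => #(won r s W u)) one_pos (modifies_seq_recordMax r) (by decide)
    (fun i σ' m h => ⟨by simpa using h.le, by simpa using h.attained⟩) (fun σ' hσ' => ?_)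
    (fun i _ σ' hσ' h3 h => ?_) ⟨by simp, by simp [Expr.eval]⟩))).mono_time (by ring_nf; omega)
  · rw [zero_add, one_mul]
    exact (hl.congr (hinit.trans hσ')).arr_zero
  · rw [zero_add, one_mul] at h3
    refine Exec.seq_of_modifies (T' := 3) (modifies_countWins r) (exec_countWins
      (hl.congr (hinit.trans hσ')) (hrem.congr (hinit.trans hσ')) hW) fun τ hτ h4 => ?_
    refine exec_recordMax ⟨?_, ?_⟩ ((hτ.var 3 (by decide)).trans h3) (by rw [h4, h3])
    · rw [hτ.var 5 (by decide)]
      exact h.le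
    · rw [hτ.var 5 (by decide), hτ.var 6 (by decide)]
      exact h.attained

theorem exists_won_nonempty (hs : IsSelection r s W) (hr : r ≤ #W) :
    ∃ v ∈ W, (won r s W v).Nonempty := by
  obtain ⟨S, hS⟩ := powersetCard_nonempty.2 hr
  exact ⟨s S, (mem_powersetCard.1 hS).1 (hs S hS), S, mem_filter.2 ⟨hS, rfl⟩⟩

theorem mem_of_won_nonempty {v : ℕ} (hs : IsSelection r s W) (hv : (won r s W v).Nonempty) :
    v ∈ W := by
  obtain ⟨S, hwon⟩ := hv
  obtain ⟨hS, rfl⟩ := mem_filter.1 hwon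
  exact (mem_powersetCard.1 hS).1 (hs S hS)

theorem MaxRecorded.isMax_won (h : MaxRecorded (fun u => #(won r s W u)) n σ) (hW : W ⊆ range n)
    (hs : IsSelection r s W) (hr : r ≤ #W) :
    σ.var 6 ∈ W ∧ #(won r s W (σ.var 6)) = σ.var 5 := by
  obtain ⟨u, hu, hwon⟩ := exists_won_nonempty hs hr
  have hpos : 0 < σ.var 5 := (card_pos.2 hwon).trans_le (h.le u (mem_range.1 (hW hu)))
  have hattained := h.attained hpos.ne'
  exact ⟨mem_of_won_nonempty hs (card_pos.1 (hattained ▸ hpos)), hattained⟩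

/-- Remove a vertex with the largest number of wins. -/
def peelStep (r : ℕ) : Prog :=
  .seq (argmaxWins r) (.seq (.write 1 (.var 6) (.lit 1))
    (.seq (.assign 7 (.add (.var 7) (.var 5))) (.assign 8 (.sub (.var 8) (.lit 1)))))

theorem modifies_peelStep (r : ℕ) : (peelStep r).Modifies [2, 3, 4, 5, 6, 7, 8] [1] :=
  ⟨(modifies_argmaxWins r).mono (by decide) (by decide), by simp [Prog.Modifies]⟩

theorem exec_peelStep (hl : Loaded (encodeSel r n k s) σ) (hrem : Remaining n W w σ)
    (hW : W ⊆ range n) (hs : IsSelection r s W) (hr : r ≤ #W) :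
    Exec (peelStep r) σ (n * (4 * n.choose r + 8) + 6) fun σ' => ∃ v ∈ W,
      (∀ u ∈ W, #(won r s W u) ≤ #(won r s W v)) ∧
        Remaining n (W.erase v) (w + #(won r s W v)) σ' := by
  refine Exec.seq_of_modifies (T' := 3) (modifies_argmaxWins r) (exec_argmaxWins hl hrem hW)
    fun τ hτ hmax => ?_
  obtain ⟨hmem, hwon⟩ := hmax.isMax_won hW hs hr
  have hremτ := hrem.congr hτ
  refine Exec.seq (T := 1) (T' := 2) (Exec.write (Exec.seq (T := 1) (T' := 1)
    (Exec.assign (Exec.assign ⟨τ.var 6, hmem, fun u hu => ?_, ?_, ?_, ?_⟩))))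
  · rw [hwon]
    exact hmax.le u (mem_range.1 (hW hu))
  · intro v hv
    simp only [Expr.eval, Store.setVar_arr, Store.setArr_arr_self, hremτ.flag v hv, mem_erase]
    split_ifs <;> tauto
  · simp [Expr.eval, hwon, hremτ.wins]
  · simp [Expr.eval, hremτ.card, card_erase_of_mem hmem]

/-- Remove vertices from the end of the ranking until at most `2 * k + (r - 1)` are left. -/
def peel (r : ℕ) : Prog :=
  .loop (.sub (.var 8) (.add (.get 3 (.lit 1)) (.add (.get 3 (.lit 1)) (.lit (r - 1)))))
    (peelStep r)

theorem exec_peel (hr : 3 ≤ r) (hs : IsSelection r s (range n))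
    (hl : Loaded (encodeSel r n k s) σ) (hrem : Remaining n (range n) 0 σ) :
    Exec (peel r) σ (n * (n * (4 * n.choose r + 8) + 7) + 1) fun σ' => ∃ W w,
      Remaining n W w σ' ∧ Peeled r s (range n) k W w ∧ #W ≤ 2 * k + (r - 1) := by
  refine (Exec.loop (N := n - (2 * k + (r - 1))) (fun i σ' => ∃ W w,
    Remaining n W w σ' ∧ Peeled r s (range n) k W w ∧ #W + i = n) (modifies_peelStep r) ?_ ?_
    ⟨_, _, hrem, Peeled.refl, by simp⟩).mono
    (Nat.add_le_add_right (Nat.mul_le_mul_right _ (Nat.sub_le _ _)) 1)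
    fun σ' ⟨W, w, hrem', hpeel, hcard⟩ => ⟨W, w, hrem', hpeel, by omega⟩
  · rintro σ' hσ' ⟨W, w, hrem', -, hcard⟩
    simp only [Expr.eval, hrem'.card, (hl.congr hσ').arr_one]
    omega
  · rintro i hi σ' hσ' ⟨W, w, hrem', hpeel, hcard⟩
    refine ⟨by simp only [Expr.eval, hrem'.card, (hl.congr hσ').arr_one]; omega, ?_⟩
    refine (exec_peelStep (hl.congr hσ') hrem' hpeel.subset (hs.mono hpeel.subset)
      (by omega)).mono le_rfl fun τ ⟨v, hv, hmax, hremτ⟩ => ?_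
    have := card_erase_add_one hv
    exact ⟨_, _, hremτ, hpeel.erase hr hs (by omega) hv hmax, by omega⟩

end Peel

section Output

variable {r n k w : ℕ} {s : Finset ℕ → ℕ} {W : Finset ℕ} {l xs as : List ℕ} {σ σ' : Store}

/-- The array `A₂` holds the new names of the vertices in `W`. -/
def Renamed (n : ℕ) (W : Finset ℕ) (σ : Store) : Prop :=
  ∀ v < n, σ.arr 2 v = Nat.count (· ∈ W) v

theorem Renamed.congr (h : Renamed n W σ) (hσ : Store.EqOff xs as σ σ')
    (ha : 2 ∉ as := by decide) : Renamed n W σ' :=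
  fun v hv => by rw [hσ.arr 2 ha, h v hv]

/-- Number the remaining vertices consecutively. -/
def rename : Prog :=
  .seq (.assign 4 (.lit 0)) (forLoop 3 0 1 (.get 3 (.lit 0)) (.seq (.write 2 (.var 3) (.var 4))
    (.cond (.get 1 (.var 3)) .skip (.assign 4 (.add (.var 4) (.lit 1))))))

theorem modifies_rename : rename.Modifies [3, 4] [2] := by
  simp [rename, modifies_forLoop, Prog.Modifies]

theorem exec_rename (hl : Loaded (encodeSel r n k s) σ) (hrem : Remaining n W w σ) :
    Exec rename σ (5 * n + 3) (Renamed n W) := by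
  have hinit : Store.EqOff [3, 4] [2] σ (σ.setVar 4 0) := Store.eqOff_setVar (by decide) 0
  refine (Exec.seq (T := 1) (Exec.assign ((Exec.forLoop (N := n) (T := 3) (xs := [4]) (as := [2])
    (fun i σ' => σ'.var 4 = Nat.count (· ∈ W) i ∧ Renamed i W σ') one_pos
    (by simp [Prog.Modifies]) (by decide) (fun i σ' m ⟨h4, hname⟩ => ⟨by simpa using h4, hname⟩)
    (fun σ' hσ' => ?_)
    (fun i hi σ' hσ' h3 h => ?_) ⟨by simp [Expr.eval], by simp [Renamed]⟩).mono le_rfl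
    fun _ h => h.2))).mono_time (by omega)
  · rw [zero_add, one_mul]
    exact (hl.congr (hinit.trans hσ')).arr_zero
  · obtain ⟨h4, hname⟩ := h
    rw [zero_add, one_mul] at h3
    have hflag := (hrem.congr (hinit.trans hσ')).flag i hi
    have hname' : Renamed (i + 1) W (σ'.setArr 2 i (σ'.var 4)) := by
      intro v hv
      rw [Store.setArr_arr_self]
      split_ifs with hvi
      · rw [hvi, h4]
      · exact hname v (by omega)
    have hA1 : (σ'.setArr 2 i (σ'.var 4)).arr 1 = σ'.arr 1 :=
      (Store.eqOff_setArr (xs := []) (List.mem_singleton_self 2) _ _).arr 1 (by decide)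
    refine Exec.seq (T := 1) (T' := 2) (Exec.write ?_)
    simp only [Expr.eval, h3]
    refine Exec.cond (T := 1) (fun hne => Exec.skip ⟨?_, hname'⟩)
      (fun h0 => Exec.assign ⟨?_, hname'⟩)
    · have hiW : i ∉ W := fun hiW => hne (by simp [Expr.eval, h3, hA1, hflag, hiW])
      rw [Nat.count_succ, if_neg hiW]
      exact h4
    · have hiW : i ∈ W := by simpa [Expr.eval, h3, hA1, hflag] using h0
      simp [Expr.eval, Nat.count_succ, hiW, h4]

/-- Let `x₉` be the number of settled constraints. -/
def countSettled (r : ℕ) : Prog :=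
  countBlocks r 9 (.sub (.lit 1) (settledExpr r))

theorem modifies_countSettled (r : ℕ) : (countSettled r).Modifies [2, 9] [] :=
  modifies_countBlocks _ _ _

theorem exec_countSettled (hl : Loaded (encodeSel r n k s) σ) (hrem : Remaining n W w σ) :
    Exec (countSettled r) σ (4 * n.choose r + 3) fun σ' =>
      σ'.var 9 = #(settled r (range n) W) := by
  refine exec_countBlocks hl (by decide) (by decide) fun l hlmem σ' hσ' hat => ?_
  rw [← eval_settledExpr (hrem.congr hσ') hlmem hat]
  simp only [Expr.eval]
  omega

/-- The entries of the block at `x₂` under their new names. -/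
def blockExprs (r : ℕ) : List Expr :=
  (List.range (r + 1)).map fun j => .get 2 (entryExpr j)

theorem eval_blockExprs_congr {e : Expr} (he : e ∈ blockExprs r) (hσ : Store.EqOff [0] [0] σ σ') :
    e.eval σ' = e.eval σ := by
  obtain ⟨j, -, rfl⟩ := List.mem_map.1 he
  simp [entryExpr, Expr.eval, hσ.var, hσ.arr]

theorem map_eval_blockExprs (hs : IsSelection r s (range n)) (hname : Renamed n W σ)
    (hl : l ∈ blocks r n) (hat : AtBlock r s l σ) :
    (blockExprs r).map (Expr.eval σ) =
      l.map (Nat.count (· ∈ W)) ++ [Nat.count (· ∈ W) (s l.toFinset)] := by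
  have hl' := toFinset_mem_powersetCard hl
  have hlt : ∀ v ∈ l.toFinset, v < n := fun v hv => mem_range.1 ((mem_powersetCard.1 hl').1 hv)
  have heval : (blockExprs r).map (Expr.eval σ) = (l ++ [s l.toFinset]).map (σ.arr 2) := by
    rw [← hat, blockExprs, List.map_map, List.map_map]
    rfl
  rw [heval, List.map_append, List.map_singleton, hname _ (hlt _ (hs _ hl'))]
  congr 1
  exact List.map_congr_left fun v hv => hname v (hlt v (List.mem_toFinset.2 hv))

/-- Output the restriction of the instance to the remaining vertices. -/
def outputRestriction (r : ℕ) : Prog :=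
  .seq (pushAll [.var 8, .sub (.add (.get 3 (.lit 1)) (.var 7)) (.var 9)])
    (forBlocks r (.cond (settledExpr r) .skip (pushAll (blockExprs r))))

theorem exec_outputBlocks (hl : Loaded (encodeSel r n k s) σ) (hrem : Remaining n W w σ)
    (hs : IsSelection r s (range n)) (hname : Renamed n W σ) :
    Exec (forBlocks r (.cond (settledExpr r) .skip (pushAll (blockExprs r)))) σ
      (n.choose r * (2 * r + 6) + 2) fun σ' => σ'.output = σ.output ++
        ((blocks r n).filter (·.toFinset ⊆ W)).flatMap fun l =>
          l.map (Nat.count (· ∈ W)) ++ [Nat.count (· ∈ W) (s l.toFinset)] := by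
  refine exec_forBlocks (T := 2 * r + 4) (xs := [0]) (as := [0]) (fun B σ' => σ'.output =
    σ.output ++ (B.filter (·.toFinset ⊆ W)).flatMap fun l =>
      l.map (Nat.count (· ∈ W)) ++ [Nat.count (· ∈ W) (s l.toFinset)])
    hl ⟨trivial, modifies_pushAll _⟩ (by decide) (by decide) (by decide) ?_ ?_ (by simp)
  · intro B σ' m hB
    exact (Store.eqOff_setVar (xs := [2]) (as := []) (by decide) m).output_eq.trans hB
  · intro B l hlmem σ' hσ' hat hB
    have hiff := eval_settledExpr (hrem.congr hσ') hlmem hat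
    rw [List.filter_append, List.flatMap_append, ← List.append_assoc, ← hB]
    refine Exec.cond (T := 2 * r + 3) (fun hne => ?_) (fun h0 => ?_)
    · refine (Exec.skip ?_).mono_time (by omega)
      simp [← hiff, hne]
    · refine (Exec.pushAll fun e he σ'' hσ'' => eval_blockExprs_congr he hσ'').mono
        (by simp [blockExprs]; omega) fun σ'' hout => ?_
      rw [hout, map_eval_blockExprs hs (hname.congr hσ') hlmem hat]
      simp [hiff.1 h0]

theorem exec_outputRestriction (hl : Loaded (encodeSel r n k s) σ) (hrem : Remaining n W w σ)
    (hs : IsSelection r s (range n)) (hname : Renamed n W σ) (hout : σ.output = []) :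
    Exec (outputRestriction r) σ (n.choose r * (2 * r + 6) + 7) fun σ' => σ'.output =
      #W :: (k + w - σ.var 9) :: ((blocks r n).filter (·.toFinset ⊆ W)).flatMap fun l =>
        l.map (Nat.count (· ∈ W)) ++ [Nat.count (· ∈ W) (s l.toFinset)] := by
  refine (Exec.seq_of_modifies (modifies_pushAll _) (Exec.pushAll ?_) fun σ' hσ' hout' =>
    (exec_outputBlocks (hl.congr hσ') (hrem.congr hσ') hs (hname.congr hσ')).mono le_rfl
      fun τ hτ => ?_).mono_time (by simp only [List.length_cons, List.length_nil]; omega)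
  · intro e he σ' hσ'
    simp only [List.mem_cons, List.not_mem_nil, or_false] at he
    obtain rfl | rfl := he <;> simp [Expr.eval, hσ'.var, hσ'.arr]
  · rw [hτ, hout', hout]
    simp [Expr.eval, hl.arr_one, hrem.wins, hrem.card]

end Output

section Kernel

variable {r w : ℕ} {W : Finset ℕ} {σ : Store} {R N : Instance r}

/-- Copy the input to the array `A₃`, and set up the registers. -/
def load : Prog :=
  .seq (.assign 1 (.var 0)) (.seq (forLoop 3 0 1 (.var 1) (.write 3 (.var 3) (.get 0 (.var 3))))
    (.seq (.assign 8 (.get 3 (.lit 0))) (.assign 0 (.lit 0))))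

theorem exec_copyInput (l : List ℕ) :
    Exec (forLoop 3 0 1 (.var 1) (.write 3 (.var 3) (.get 0 (.var 3))))
      ((Store.input l).setVar 1 l.length) (3 * l.length + 2) fun σ =>
        Store.EqOff [1, 3] [3] (Store.input l) σ ∧ Loaded l σ := by
  have hinit : Store.EqOff [1, 3] [3] (Store.input l) ((Store.input l).setVar 1 l.length) :=
    Store.eqOff_setVar (by decide) _
  refine (Exec.forLoop (N := l.length) (T := 1) (xs := []) (as := [3])
    (fun i σ => Store.EqOff [1, 3] [3] (Store.input l) σ ∧ σ.var 1 = l.length ∧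
      ∀ j < i, σ.arr 3 j = l.getD j 0) one_pos
    (by simp [Prog.Modifies]) (by decide)
    (fun i σ m ⟨h, h1, h3⟩ => ⟨h.trans (Store.eqOff_setVar (by decide) m), by simpa using h1, h3⟩)
    (fun σ hσ => ?_) (fun i _ σ _ hvar ⟨h, h1, h3⟩ => Exec.write ⟨?_, h1, fun j hj => ?_⟩)
    ⟨hinit, by simp, by simp⟩).mono (by omega) fun σ ⟨h, h1, h3⟩ => ⟨h, h1, h3⟩
  · simpa [Expr.eval] using hσ.var 1 (by decide)
  · exact h.trans (Store.eqOff_setArr (by decide) _ _)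
  · rw [zero_add, one_mul] at hvar
    rw [Store.setArr_arr_self]
    simp only [Expr.eval, hvar]
    split_ifs with hji
    · rw [h.arr 0 (by decide), hji]
      rfl
    · exact h3 j (by omega)

theorem exec_load (r n k : ℕ) (s : Finset ℕ → ℕ) :
    Exec load (Store.input (encodeSel r n k s)) (3 * (encodeSel r n k s).length + 5) fun σ =>
      σ.output = [] ∧ Loaded (encodeSel r n k s) σ ∧ Remaining n (range n) 0 σ := by
  refine (Exec.seq (T := 1) (Exec.assign (Exec.seq (T' := 1 + 1) ((exec_copyInput _).mono le_rfl
    fun σ ⟨hσ, hl⟩ => Exec.seq (Exec.assign (Exec.assign ⟨by simp [Store.output, Expr.eval],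
      ?_, ⟨fun v hv => ?_, ?_, ?_⟩⟩)))))).mono_time (by omega)
  · exact ⟨by simp [hl.length], hl.getD⟩
  · simp [hσ.arr 1 (by decide), Store.input, hv]
  · simp [hσ.var 7 (by decide), Store.input]
  · simp [Expr.eval, hl.arr_zero]

/-- The size of the kernel; `r + 1` is the number of vertices of the fixed `No`-instance. -/
def kernelBound (r k : ℕ) : ℕ :=
  max (r + 1) (2 * k + (r - 1))

/-- `R'` is an equivalent instance with at most `g k` vertices and parameter at most `k`, where `k`
is the parameter of `R`: a correct output of the kernelization. -/
structure IsKernel (g : ℕ → ℕ) (R R' : Instance r) : Prop where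
  isYes_iff : R'.IsYes ↔ R.IsYes
  n_le : R'.n ≤ g R.k
  k_le : R'.k ≤ R.k

theorem isKernel_restriction (h : Peeled r R.selNat (range R.n) R.k W w)
    (hW : #W ≤ 2 * R.k + (r - 1)) (hle : #(settled r (range R.n) W) ≤ R.k + w) :
    IsKernel (kernelBound r) R
      (R.restriction W h.subset (R.k + w - #(settled r (range R.n) W))) where
  isYes_iff := by rw [Instance.isYes_restriction, R.isYes_iff, h.isYesOn_iff, and_iff_right hle]
  n_le := le_max_of_le_right hW
  k_le := Nat.sub_le_iff_le_add.2 (Nat.add_le_add_left h.le_settled _)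

theorem isKernel_of_lt_settled (h : Peeled r R.selNat (range R.n) R.k W w)
    (hlt : R.k + w < #(settled r (range R.n) W)) (hn : N.n = r + 1) (hk : N.k = 0)
    (hN : ¬ N.IsYes) : IsKernel (kernelBound r) R N where
  isYes_iff := iff_of_false hN fun hR =>
    hlt.not_ge (h.isYesOn_iff.1 (R.isYes_iff.1 hR)).1
  n_le := le_max_of_le_left hn.le
  k_le := hk ▸ Nat.zero_le _

/-- Output the kernel: the restriction to the remaining vertices, or the encoding `out` of a fixed
`No`-instance if the settled constraints exceed the budget. -/
def outputKernel (r : ℕ) (out : List ℕ) : Prog :=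
  .cond (.sub (.var 9) (.add (.get 3 (.lit 1)) (.var 7))) (pushAll (out.map .lit))
    (outputRestriction r)

theorem exec_outputKernel (hl : Loaded (encodeSel r R.n R.k R.selNat) σ)
    (hrem : Remaining R.n W w σ) (h : Peeled r R.selNat (range R.n) R.k W w)
    (hW : #W ≤ 2 * R.k + (r - 1)) (hname : Renamed R.n W σ)
    (hsettled : σ.var 9 = #(settled r (range R.n) W)) (hout : σ.output = [])
    (hn : N.n = r + 1) (hk : N.k = 0) (hN : ¬ N.IsYes) :
    Exec (outputKernel r N.encode) σ
      ((2 * N.encode.length + 1) + (R.n.choose r * (2 * r + 6) + 7) + 1) fun σ' =>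
        ∃ R', IsKernel (kernelBound r) R R' ∧ σ'.output = R'.encode := by
  refine Exec.cond (fun hlt => (Exec.pushAll ?_).mono (by simp) fun σ' hσ' =>
    ⟨N, isKernel_of_lt_settled h ?_ hn hk hN, ?_⟩) (fun hle =>
    (exec_outputRestriction hl hrem R.isSelection_selNat hname hout).mono (Nat.le_add_left _ _)
      fun σ' hσ' => ⟨_, isKernel_restriction h hW ?_, ?_⟩)
  · simp only [List.forall_mem_map]
    exact fun _ _ _ _ => rfl
  · simpa [Expr.eval, hl.arr_one, hrem.wins, hsettled, Nat.sub_ne_zero_iff_lt] using hlt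
  · rw [hσ', hout, List.map_map]
    exact List.map_id _
  · simpa [Expr.eval, hl.arr_one, hrem.wins, hsettled, Nat.sub_eq_zero_iff_le] using hle
  · rw [hσ', hsettled, Instance.encode_restriction]

/-- The kernelization. -/
def kernelize (r : ℕ) (out : List ℕ) : Prog :=
  .seq load (.seq (peel r) (.seq rename (.seq (countSettled r) (outputKernel r out))))

/-- A bound for the number of steps of the kernelization, where `n` is the number of vertices, `m`
the number of constraints and `o` the length of the encoding of the fixed `No`-instance. Taking
values in a semiring, it yields both numbers and polynomials. -/
def stepBound {A : Type*} [CommSemiring A] (r o n m : A) : A :=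
  (3 * (2 + (r + 1) * m) + 5) + ((n * (n * (4 * m + 8) + 7) + 1) + ((5 * n + 3) + ((4 * m + 3) +
    ((2 * o + 1) + (m * (2 * r + 6) + 7) + 1))))

theorem exec_kernelize (hr : 3 ≤ r) (R : Instance r) (hn : N.n = r + 1) (hk : N.k = 0)
    (hN : ¬ N.IsYes) :
    Exec (kernelize r N.encode) (Store.input R.encode)
      (stepBound r N.encode.length R.n (R.n.choose r)) fun σ =>
        ∃ R', IsKernel (kernelBound r) R R' ∧ σ.output = R'.encode := by
  rw [R.encode_eq]
  refine Exec.seq ((exec_load r R.n R.k R.selNat).mono (by rw [length_encodeSel])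
    fun σ₁ ⟨hout, hl, hrem⟩ => ?_)
  refine Exec.seq_of_modifies (modifies_peelStep r) (exec_peel hr R.isSelection_selNat hl hrem)
    fun σ₂ h₁₂ ⟨W, w, hrem, hpeel, hW⟩ => ?_
  replace hl := hl.congr h₁₂
  refine Exec.seq_of_modifies modifies_rename (exec_rename hl hrem) fun σ₃ h₂₃ hname => ?_
  replace hl := hl.congr h₂₃
  replace hrem := hrem.congr h₂₃
  refine Exec.seq_of_modifies (modifies_countSettled r) (exec_countSettled hl hrem)
    fun σ₄ h₃₄ hsettled => ?_
  refine exec_outputKernel (hl.congr h₃₄) (hrem.congr h₃₄) hpeel hW (hname.congr h₃₄) hsettled ?_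
    hn hk hN
  rw [h₃₄.output_eq, h₂₃.output_eq, h₁₂.output_eq, hout]

end Kernel

section Bounds

variable {r : ℕ}

theorem length_le_bitLength (l : List ℕ) : l.length ≤ bitLength l := by
  rw [bitLength, ← List.length_map (f := fun m => Nat.size m + 1)]
  refine List.length_le_sum_of_one_le _ fun m hm => ?_
  obtain ⟨_, -, rfl⟩ := List.mem_map.1 hm
  exact Nat.le_add_left _ _

theorem choose_le_bitLength (R : Instance r) : R.n.choose r ≤ bitLength R.encode :=
  calc R.n.choose r ≤ 2 + (r + 1) * R.n.choose r :=
        (Nat.le_mul_of_pos_left _ r.succ_pos).trans (Nat.le_add_left _ _)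
    _ = R.encode.length := by rw [R.encode_eq, length_encodeSel]
    _ ≤ bitLength R.encode := length_le_bitLength _

theorem card_vertices_le (hr : r ≠ 0) (R : Instance r) : R.n ≤ bitLength R.encode + r := by
  have hlow := add_one_sub_le_choose (n := R.n) hr
  have hup := choose_le_bitLength R
  omega

theorem stepBound_mono (r o : ℕ) {n n' m m' : ℕ} (hn : n ≤ n') (hm : m ≤ m') :
    stepBound r o n m ≤ stepBound r o n' m' := by
  unfold stepBound
  gcongr

theorem eval_stepBound (r o x : ℕ) :
    (stepBound (.C r) (.C o) (.X + .C r) .X : Polynomial ℕ).eval x = stepBound r o (x + r) x := by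
  simp [stepBound]

theorem admitsVertexKernel_of_exec {g : ℕ → ℕ} (p : Prog) (P : Polynomial ℕ)
    (h : ∀ R : Instance r, Exec p (Store.input R.encode) (P.eval (bitLength R.encode)) fun σ =>
      ∃ R', IsKernel g R R' ∧ σ.output = R'.encode) : AdmitsVertexKernel r g := by
  choose σ t hrun ht R' hR' hout using h
  exact ⟨R', ⟨p, P, fun R => ⟨σ R, t R, hrun R, ht R, hout R⟩⟩,
    fun R => ⟨(hR' R).isYes_iff, (hR' R).n_le, (hR' R).k_le⟩⟩

theorem AdmitsVertexKernel.mono {g g' : ℕ → ℕ} (h : AdmitsVertexKernel r g) (hg : g ≤ g') :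
    AdmitsVertexKernel r g' := by
  obtain ⟨f, hf, hkernel⟩ := h
  exact ⟨f, hf, fun R => ⟨(hkernel R).1, (hkernel R).2.1.trans (hg R.k), (hkernel R).2.2⟩⟩

end Bounds

end DenseFAS

theorem mainTheorem3_general (r : ℕ) (hr : 3 ≤ r) :
    DenseFAS.AdmitsVertexKernel r fun k => max (r + 1) (2 * k + (r - 1)) := by
  obtain ⟨N, hn, hk, hN⟩ := DenseFAS.Instance.exists_not_isYes hr
  refine DenseFAS.admitsVertexKernel_of_exec (DenseFAS.kernelize r N.encode)
    (DenseFAS.stepBound (.C r) (.C N.encode.length) (.X + .C r) .X) fun R =>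
      (DenseFAS.exec_kernelize hr R hn hk hN).mono_time ?_
  rw [DenseFAS.eval_stepBound]
  exact DenseFAS.stepBound_mono _ _ (DenseFAS.card_vertices_le (by omega) R)
    (DenseFAS.choose_le_bitLength R)

theorem mainTheorem3 (r : ℕ) (hr : 3 ≤ r) :
    DenseFAS.AdmitsVertexKernel r (fun k => if k = 0 then r + 1 else 6 * k + r) := by
  refine (mainTheorem3_general r hr).mono fun k => ?_
  dsimp only
  split_ifs <;> omega
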